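/- **Shuffle model.** An $m$-message protocol for $n\ge 2$ users is a pair (local randomizer $R$, analyzer $A$). Each user $i$ independently computes $(y_i^{(1)},\dots,y_i^{(m)})=R(x_i)$; for each $j$ the messages $y^{(j)}_1,\dots,y^{(j)}_n$ are permuted by a uniformly random permutation, independently over $j$. The tuple of the $m$ shuffled $n$-tuples is the view $V(x)$, and the output is $M(x)=A(V(x))$. The protocol is $(\epsilon,\delta)$-DP if $\Pr[V(x)\in E]-e^{\epsilon}\Pr[V(x')\in E]\le\delta$ for all events $E$ and all inputs $x,x'$ that differ in a single coordinate. Its mean squared error is $\mathrm{MSE}=\sup_{x\in[0,1]^n}\mathbb E\big[(M(x)-\sum_i x_i)^2\big]$. **Recursive protocol.** Given precisions $p_1,\dots,p_m\in\mathbb N_{\ge1}$ and $\gamma_1,\dots,\gamma_m\in[0,1]$, let $q_j=p_1\cdots p_j$ for $j\ge1$, $q_0=0$, and $d_j=p_j+\mathbb I_{j=m}$. On input $x\in[0,1]$ the randomizer computes $s_j=\lfloor q_jx-p_j\lfloor q_{j-1}x\rfloor\rfloor$ for $1\le j\le m$, adds to $s_m$ an independent bit $r\sim\mathrm{Ber}(q_mx-p_m\lfloor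 q_{m-1}x\rfloor-s_m)$, and, independently for each $j$, sends as $j$-th message $s_j$ with probability $1-\gamma_j$ and a uniform element of $\{0,\dots,d_j\}$ with probability $\gamma_j$. The analyzer outputs $$\sum_{j=1}^m\frac{z_j}{q_j},\qquad z_j=\frac{\sum_{i=1}^n y_i^{(j)}-n\gamma_jd_j/2}{1-\gamma_j}.$$ **Theorem.** There is an absolute constant $C>0$ such that the following holds. Let $n\ge2$, $m\ge1$, $0<\epsilon\le m$, $\delta>0$ and $\log(1/\delta)\ge2\epsilon$. Take $\epsilon_j=\epsilon/m$, $\delta_j=\delta/m$, $$\gamma_j=\frac{14\,(p_j+\mathbb I_{j=m})\log(2/\delta_j)}{(n-1)\,\epsilon_j^2},$$ and let each $p_j$ be $n^{3^{j-m-1}}$, rounded up or down to an integer. Suppose that $\gamma_j\le1$ for all $j$, so that the protocol is defined. 1. The $m$-message recursive protocol is $(\epsilon,\delta)$-DP, and if $\gamma_j\le\kappa<1$ for all $j$, then $$\mathrm{MSE}\le\frac{C\log(2/\delta_j)}{(1-\kappa)^2}\;n^{3^{-m}}\Big(1+\frac{m^3}{\epsilon^2}\Big).$$ If moreover $\delta\le1/m$,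 the factor $\log(2/\delta_j)=\log(2m/\delta)$ can be replaced by $\log(2/\delta)$, so that $\mathrm{MSE}=O_\delta\big(n^{3^{-m}}(1+m^3/\epsilon^2)\big)$, with an implied constant $C\log(2/\delta)/(1-\kappa)^2$. 2. If $m=\lfloor\log_3\log_2n\rfloor$, then for the same $p_j$, and also for $p_j=2^{3^j}$ with $\gamma_j$ given by the same formula and $\gamma_j\le 1$, the protocol is $(\epsilon,\delta)$-DP, and if $\gamma_j\le\kappa<1$ for all $j$, then $$\mathrm{MSE}\le\frac{C\log(2/\delta_j)}{(1-\kappa)^2}\;\frac{(\log\log n)^3}{\epsilon^2},$$ where for $\delta\le1/m$ the factor $\log(2/\delta_j)$ can again be replaced by $\log(2/\delta)$, so that $\mathrm{MSE}=O_\delta\big((\log\log n)^3/\epsilon^2\big)$. 3. For the rounded precisions the condition on the $\gamma_j$ holds for all large $n$: for all $\epsilon>0$ and $k\in\mathbb N$ there is $N$ such that for all $n\ge N$, all $1\le m\le\log_3\log_2n$ and all $n^{-k}\le\delta<1$ one has $0\le\gamma_j\le1/2$ for every $j$. -/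

import Mathlib

noncomputable section

/-! ### Discrete randomness -/

/-- The joint law of independent random variables with laws `μ i`, each on a finite type. -/
def pmfPi {ι : Type} [Fintype ι] {α : ι → Type} [∀ i, Fintype (α i)]
    (μ : ∀ i, PMF (α i)) : PMF (∀ i, α i) :=
  haveI : DecidableEq ι := Classical.decEq ι
  PMF.ofFintype (fun f => ∏ i, μ i (f i)) (by
    have h := Finset.prod_univ_sum (fun i => (Finset.univ : Finset (α i))) (fun i a => μ i a)
    rw [Fintype.piFinset_univ] at h
    rw [← h]
    refine Finset.prod_eq_one fun i _ => ?_
    have h1 := (μ i).tsum_coe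
    rwa [tsum_fintype] at h1)

/-- A Bernoulli variable with success probability `γ ∈ [0,1]` (`true` is success). -/
def berUnit (γ : unitInterval) : PMF Bool :=
  PMF.ofFintype (fun b => ENNReal.ofReal (if b then (γ : ℝ) else 1 - γ)) (by
    have h0 := γ.2.1
    have h1 := γ.2.2
    rw [Fintype.sum_bool, ← ENNReal.ofReal_add (by simpa using h0) (by simpa using h1)]
    simp)

/-! ### The shuffle model -/

/-- An `m`-message protocol for `n` users: a local randomizer, which produces the `m` messages of
one user, and an analyzer, which reads the outputs of the `m` shufflers. The `j`-th messages of
the users live in `Y j`. -/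
structure ShuffleProtocol (n m : ℕ) (X : Type) (Y : Fin m → Type) (O : Type) where
  randomizer : X → PMF (∀ j, Y j)
  analyzer : (∀ j, Fin n → Y j) → O

namespace ShuffleProtocol

variable {n m : ℕ} {X : Type} {Y : Fin m → Type} {O : Type} [∀ j, Fintype (Y j)]

/-- The view of the data collector: the users randomize their inputs independently, and the
`j`-th messages of all users are permuted by the `j`-th shuffler; the `m` shufflers use
independent uniform permutations. -/
def view (P : ShuffleProtocol n m X Y O) (x : Fin n → X) : PMF (∀ j, Fin n → Y j) :=
  (pmfPi fun i : Fin n => P.randomizer (x i)).bind fun y =>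
    (pmfPi fun _ : Fin m => PMF.uniformOfFintype (Equiv.Perm (Fin n))).map fun σ =>
      fun j i => y (σ j i) j

/-- The randomized mechanism computed by the protocol: the analyzer applied to the view. -/
def mechanism (P : ShuffleProtocol n m X Y O) (x : Fin n → X) : PMF O :=
  (P.view x).map P.analyzer

/-- `(ε, δ)`-differential privacy in the shuffle model, a property of the view. -/
def IsDP (P : ShuffleProtocol n m X Y O) (ε δ : ℝ) : Prop :=
  ∀ x x' : Fin n → X, (∃ i, ∀ k, k ≠ i → x k = x' k) →
    ∀ E : Set (∀ j, Fin n → Y j),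
      ((P.view x).toOuterMeasure E).toReal
        - Real.exp ε * ((P.view x').toOuterMeasure E).toReal ≤ δ

/-- Worst-case mean squared error of a protocol for summing `n` real numbers in `[0,1]`. -/
def MSE (P : ShuffleProtocol n m unitInterval Y ℝ) : ENNReal :=
  ⨆ x : Fin n → unitInterval,
    ∫⁻ z, ENNReal.ofReal ((z - ∑ i, (x i : ℝ)) ^ 2) ∂(P.mechanism x).toMeasure

end ShuffleProtocol

/-! ### The discrete summation subprotocol on `{0, …, d}` -/

/-- Randomized response: the input is kept with probability `1 - γ`, and replaced by a uniform
element of `{0, …, d}` with probability `γ`. -/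
def randResponse (γ : unitInterval) (d : ℕ) (x : Fin (d + 1)) : PMF (Fin (d + 1)) :=
  (berUnit γ).bind fun b =>
    if b then PMF.uniformOfFintype (Fin (d + 1)) else PMF.pure x

/-- The analyzer of the discrete protocol: the sum of the messages, debiased. A uniform element of
`{0, …, d}` has mean `d / 2`. -/
def debiasedSum {n : ℕ} (γ : ℝ) (d : ℕ) (y : Fin n → Fin (d + 1)) : ℝ :=
  ((∑ i, ((y i : ℕ) : ℝ)) - n * γ * d / 2) / (1 - γ)

/-! ### The recursive protocol

Messages are indexed by `j : Fin m`, so the `j`-th message in the usual counting has index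
`j - 1`. The precisions are `p : Fin m → ℕ`. -/

/-- The indicator of the last message. -/
def lastInd {m : ℕ} (j : Fin m) : ℕ := if (j : ℕ) + 1 = m then 1 else 0

/-- The `j`-th message is in `{0, …, msgRange p j}`: the last message has one extra value, which
leaves room for the randomized rounding. -/
def msgRange {m : ℕ} (p : Fin m → ℕ) (j : Fin m) : ℕ := p j + lastInd j

/-- `q_j`, the product of the precisions up to and including index `j`. -/
def precProd {m : ℕ} (p : Fin m → ℕ) (j : Fin m) : ℕ := ∏ l ∈ Finset.Iic j, p l

/-- `q_{j-1}`, the product of the precisions before index `j`, where `q_0 = 0`. -/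
def prevProd {m : ℕ} (p : Fin m → ℕ) (j : Fin m) : ℕ :=
  if (j : ℕ) = 0 then 0 else ∏ l ∈ Finset.Iio j, p l

/-- `q_j x - p_j ⌊q_{j-1} x⌋`, the part of `x` that is left for message `j`, at scale `q_j`. -/
def leftover {m : ℕ} (p : Fin m → ℕ) (x : unitInterval) (j : Fin m) : ℝ :=
  precProd p j * (x : ℝ) - p j * (⌊(prevProd p j : ℝ) * (x : ℝ)⌋ : ℝ)

theorem leftover_le {m : ℕ} (p : Fin m → ℕ) (x : unitInterval) (j : Fin m) :
    leftover p x j ≤ p j := by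
  have hx := x.2.2
  have hp : (0 : ℝ) ≤ p j := Nat.cast_nonneg _
  unfold leftover prevProd
  split_ifs with h
  · have hj : Finset.Iic j = {j} := by
      ext l
      simp only [Finset.mem_Iic, Finset.mem_singleton, Fin.le_def, Fin.ext_iff]
      omega
    have hq : precProd p j = p j := by simp [precProd, hj]
    rw [hq]
    simp only [Nat.cast_zero, zero_mul, Int.floor_zero, Int.cast_zero, mul_zero, sub_zero]
    exact mul_le_of_le_one_right hp hx
  · have hq : precProd p j = p j * ∏ l ∈ Finset.Iio j, p l := by
      rw [precProd, ← Finset.Iio_insert, Finset.prod_insert (by simp)]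
    rw [hq, Nat.cast_mul, mul_assoc, ← mul_sub]
    refine mul_le_of_le_one_right hp ?_
    have := Int.lt_floor_add_one (((∏ l ∈ Finset.Iio j, p l : ℕ) : ℝ) * (x : ℝ))
    linarith

/-- `s_j = ⌊q_j x - p_j ⌊q_{j-1} x⌋⌋`, an element of `{0, …, p_j}`. -/
def digit {m : ℕ} (p : Fin m → ℕ) (x : unitInterval) (j : Fin m) : ℕ := ⌊leftover p x j⌋₊

theorem digit_le {m : ℕ} (p : Fin m → ℕ) (x : unitInterval) (j : Fin m) :
    digit p x j ≤ p j := by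
  have h := Nat.floor_le_floor (leftover_le p x j)
  rwa [Nat.floor_natCast] at h

/-- The law of the number that message `j` encodes: the digit `s_j`, to which in the last message
the rounding bit `r ~ Ber(q_m x - p_m ⌊q_{m-1} x⌋ - s_m)` is added. -/
def roundedDigit {m : ℕ} (p : Fin m → ℕ) (x : unitInterval) (j : Fin m) :
    PMF (Fin (msgRange p j + 1)) :=
  (berUnit ⟨Int.fract (leftover p x j), Int.fract_nonneg _, (Int.fract_lt_one _).le⟩).map fun r =>
    ⟨digit p x j + (if r then lastInd j else 0), by
      have h := digit_le p x j
      unfold msgRange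
      split_ifs <;> omega⟩

/-- The recursive protocol: message `j` is the randomized response, with probability `γ j`, of the
`j`-th (rounded) digit, and the analyzer adds up the debiased sums, scaled by `1 / q_j`. -/
def recProtocol (n : ℕ) {m : ℕ} (p : Fin m → ℕ) (γ : Fin m → unitInterval) :
    ShuffleProtocol n m unitInterval (fun j => Fin (msgRange p j + 1)) ℝ where
  randomizer x := pmfPi fun j => (roundedDigit p x j).bind (randResponse (γ j) (msgRange p j))
  analyzer y := ∑ j, debiasedSum (γ j : ℝ) (msgRange p j) (y j) / precProd p j

/-- `γ_j = 14 (p_j + 𝟙[j = m]) log(2 / δ_j) / ((n - 1) ε_j²)` with `ε_j = ε / m`, `δ_j = δ / m`. -/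
def recGamma (n : ℕ) {m : ℕ} (ε δ : ℝ) (p : Fin m → ℕ) (j : Fin m) : ℝ :=
  14 * ((p j : ℝ) + (lastInd j : ℝ)) * Real.log (2 / (δ / m)) / (((n : ℝ) - 1) * (ε / m) ^ 2)

/-- Each `p_j` is the real number `n ^ (3 ^ (j - m - 1))` rounded up or down to an integer; the
message with index `j : Fin m` is number `j + 1`. -/
def IsRoundedPrec (n : ℕ) {m : ℕ} (p : Fin m → ℕ) : Prop :=
  ∀ j : Fin m, |(p j : ℝ) - (n : ℝ) ^ ((3 : ℝ) ^ (((j : ℕ) : ℤ) - (m : ℤ)))| < 1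

end

/-! Privacy. The messages of a user are independent, so the view is a product of `m` shuffled tuples
(`ShuffleProtocol.view_eq_pmfPi`), and basic composition (`DPClose.pmfPi`) leaves one shuffler with
privacy parameters `ε / m ≤ 1` and `δ / m`. There each message is a mixture of a data-independent
blanket, of weight `c = γ / (d + 1)` on every value, and a rest that depends on the input. By
convexity it is enough to compare two fixed messages `a ≠ a'` of the one user whose input changes.
If that user sends noise, swapping with another noisy user changes no weight; so, for
permutation-invariant tests, the indicator that the user sends `a` can be replaced by `N a / N`, the
share of `a` among the noisy messages (`sum_blanketWeight_symm`). The excess `N a - exp ε * N a'` is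
at most `N a * exp (t * (N a - exp ε * N a'))` where it is positive, and the same exchange read
backwards turns this into an exponential moment, which factorizes over the users. The choice `t = ε
/ 4` makes it at most `2 * exp (-(n - 1) * c * ε ^ 2 / 7)`.

Error. The digit means, weighted by place value, telescope to `x` (`sum_digitMean_div`), so the
estimate is unbiased and variances add over users and messages. Message `j` contributes of order `n
* γ_j * p_j ^ 2 / q_j ^ 2`, that is, `log (2 / δ_j) * (m / ε) ^ 2` times `p_j / q_{j-1} ^ 2` with
the empty product read as `1`; the rounding bit adds of order `n / q_m ^ 2`. All these ratios are
balanced if each precision is a fixed multiple `K` of the squared product of its predecessors, with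
`n` as the next term. This forces `p_{j+1} = p_j ^ 3` and `K = p_1 = n ^ (3 ^ (-m))`; the sum over
the messages gives `m ^ 3`.

Rounding to integers must cost a constant independent of `m`, although many ideal precisions may be
close to `1`. A bounded potential pays for it (`mul_potential_le`, `idealPrec_le_potential`). For `m
= ⌊log₃ log₂ n⌋` one has `K = O(1)` and `m = O(log log n)`. -/

noncomputable section

/-! ### Expectations over finite types -/

/-- The expectation of a real function under a law on a finite type. -/
def finExp {α : Type} [Fintype α] (μ : PMF α) (f : α → ℝ) : ℝ := ∑ a, (μ a).toReal * f a

section finExp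

variable {α β : Type} [Fintype α]

theorem pmf_sum_toReal (μ : PMF α) : ∑ a, (μ a).toReal = 1 := by
  rw [← ENNReal.toReal_sum fun a _ => μ.apply_ne_top a, ← tsum_fintype (L := .unconditional α),
    μ.tsum_coe, ENNReal.toReal_one]

theorem finExp_const (μ : PMF α) (c : ℝ) : finExp μ (fun _ => c) = c := by
  rw [finExp, ← Finset.sum_mul, pmf_sum_toReal, one_mul]

theorem finExp_add (μ : PMF α) (f g : α → ℝ) :
    finExp μ (fun a => f a + g a) = finExp μ f + finExp μ g := by
  simp only [finExp, mul_add, Finset.sum_add_distrib]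

theorem finExp_sub (μ : PMF α) (f g : α → ℝ) :
    finExp μ (fun a => f a - g a) = finExp μ f - finExp μ g := by
  simp only [finExp, mul_sub, Finset.sum_sub_distrib]

theorem finExp_mul_const (μ : PMF α) (f : α → ℝ) (c : ℝ) :
    finExp μ (fun a => f a * c) = finExp μ f * c := by
  simp only [finExp, Finset.sum_mul, mul_assoc]

theorem finExp_sum {ι : Type} (s : Finset ι) (μ : PMF α) (f : ι → α → ℝ) :
    finExp μ (fun a => ∑ i ∈ s, f i a) = ∑ i ∈ s, finExp μ (f i) := by
  simp only [finExp, Finset.mul_sum]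
  exact Finset.sum_comm

theorem finExp_mono (μ : PMF α) {f g : α → ℝ} (h : ∀ a, f a ≤ g a) :
    finExp μ f ≤ finExp μ g :=
  Finset.sum_le_sum fun a _ => mul_le_mul_of_nonneg_left (h a) ENNReal.toReal_nonneg

theorem pmf_bind_toReal (μ : PMF α) (κ : α → PMF β) (b : β) :
    (μ.bind κ b).toReal = finExp μ fun a => (κ a b).toReal := by
  rw [PMF.bind_apply, tsum_fintype, ENNReal.toReal_sum]
  · simp only [ENNReal.toReal_mul, finExp]
  · exact fun a _ => ENNReal.mul_ne_top (μ.apply_ne_top a) ((κ a).apply_ne_top b)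

theorem finExp_bind [Fintype β] (μ : PMF α) (κ : α → PMF β) (f : β → ℝ) :
    finExp (μ.bind κ) f = finExp μ fun a => finExp (κ a) f := by
  simp only [finExp, pmf_bind_toReal, Finset.mul_sum, Finset.sum_mul]
  rw [Finset.sum_comm]
  exact Finset.sum_congr rfl fun a _ => Finset.sum_congr rfl fun b _ => by ring

theorem finExp_pure (a : α) (f : α → ℝ) : finExp (PMF.pure a) f = f a := by
  classical
  simp [finExp, PMF.pure_apply, apply_ite ENNReal.toReal]

theorem finExp_map [Fintype β] (μ : PMF α) (h : α → β) (f : β → ℝ) :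
    finExp (μ.map h) f = finExp μ fun a => f (h a) := by
  simp only [PMF.map, finExp_bind, Function.comp_apply, finExp_pure]

theorem finExp_uniform [Nonempty α] (f : α → ℝ) :
    finExp (PMF.uniformOfFintype α) f = (∑ a, f a) / Fintype.card α := by
  simp only [finExp, PMF.uniformOfFintype_apply, ENNReal.toReal_inv, ENNReal.toReal_natCast]
  rw [← Finset.mul_sum, div_eq_inv_mul]

theorem finExp_berUnit (γ : unitInterval) (f : Bool → ℝ) :
    finExp (berUnit γ) f = γ * f true + (1 - γ) * f false := by
  simp [finExp, berUnit, ENNReal.toReal_ofReal γ.2.1,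
    ENNReal.toReal_ofReal (sub_nonneg.2 γ.2.2)]

theorem toOuterMeasure_toReal (μ : PMF α) (E : Set α) :
    (μ.toOuterMeasure E).toReal = finExp μ (E.indicator 1) := by
  classical
  rw [PMF.toOuterMeasure_apply_fintype, ENNReal.toReal_sum]
  · refine Finset.sum_congr rfl fun a _ => ?_
    by_cases h : a ∈ E <;> simp [h]
  · intro a _
    by_cases h : a ∈ E <;> simp [h, μ.apply_ne_top a]

end finExp

/-! ### Product laws -/

section pmfPi

variable {ι : Type} [Fintype ι] {α β : ι → Type} [∀ i, Fintype (α i)] [∀ i, Fintype (β i)]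

theorem pmfPi_apply (μ : ∀ i, PMF (α i)) (f : ∀ i, α i) : pmfPi μ f = ∏ i, μ i (f i) := rfl

theorem finExp_pmfPi_prod [DecidableEq ι] (μ : ∀ i, PMF (α i)) (f : ∀ i, α i → ℝ) :
    finExp (pmfPi μ) (fun y => ∏ i, f i (y i)) = ∏ i, finExp (μ i) (f i) := by
  simp only [finExp, pmfPi_apply, ENNReal.toReal_prod, ← Finset.prod_mul_distrib]
  rw [Finset.prod_univ_sum, Fintype.piFinset_univ]

theorem finExp_pmfPi_eval [DecidableEq ι] (μ : ∀ i, PMF (α i)) (i : ι) (g : α i → ℝ) :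
    finExp (pmfPi μ) (fun y => g (y i)) = finExp (μ i) g := by
  -- A function of one coordinate is a product whose other factors are `1`; each of those integrates
  -- to `1`.
  have h := finExp_pmfPi_prod μ (fun k y => if hk : k = i then g (hk ▸ y) else 1)
  have h1 : ∀ y : ∀ i, α i, (∏ k, if hk : k = i then g (hk ▸ y k) else (1 : ℝ)) = g (y i) := by
    intro y
    rw [Finset.prod_eq_single i (fun k _ hk => by simp [hk]) (by simp)]
    simp
  simp only [h1] at h
  rw [h, Finset.prod_eq_single i (fun k _ hk => by simp [hk, finExp_const]) (by simp)]
  simp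

theorem finExp_pmfPi_mul [DecidableEq ι] (μ : ∀ i, PMF (α i)) {i k : ι} (hik : i ≠ k)
    (g : ∀ i, α i → ℝ) :
    finExp (pmfPi μ) (fun y => g i (y i) * g k (y k)) =
      finExp (μ i) (g i) * finExp (μ k) (g k) := by
  have h := finExp_pmfPi_prod μ (fun l y => if l = i ∨ l = k then g l y else 1)
  have aux : ∀ F : ι → ℝ, (∏ l, if l = i ∨ l = k then F l else (1 : ℝ)) = F i * F k := by
    intro F
    rw [Finset.prod_eq_mul i k hik (fun c _ hc => by simp [hc.1, hc.2]) (by simp) (by simp)]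
    simp
  have h2 : ∀ l, finExp (μ l) (fun y => if l = i ∨ l = k then g l y else 1) =
      if l = i ∨ l = k then finExp (μ l) (g l) else 1 := by
    intro l
    split_ifs
    · rfl
    · exact finExp_const _ _
  simp only [h2, aux fun l => finExp (μ l) (g l)] at h
  rw [← h]
  congr 1
  ext y
  exact (aux fun l => g l (y l)).symm

/-- The variance of a sum of independent variables is the sum of the variances. -/
theorem finExp_pmfPi_sum_sq [DecidableEq ι] (μ : ∀ i, PMF (α i)) (g : ∀ i, α i → ℝ)
    (h0 : ∀ i, finExp (μ i) (g i) = 0) :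
    finExp (pmfPi μ) (fun y => (∑ i, g i (y i)) ^ 2) =
      ∑ i, finExp (μ i) (fun a => g i a ^ 2) := by
  simp only [sq, Finset.sum_mul_sum, finExp_sum]
  refine Finset.sum_congr rfl fun i _ => ?_
  rw [Finset.sum_eq_single i]
  · exact finExp_pmfPi_eval μ i fun a => g i a * g i a
  · intro k _ hk
    rw [finExp_pmfPi_mul μ hk.symm, h0, zero_mul]
  · simp

theorem finExp_pmfPi_sum [DecidableEq ι] (μ : ∀ i, PMF (α i)) (g : ∀ i, α i → ℝ) :
    finExp (pmfPi μ) (fun y => ∑ i, g i (y i)) = ∑ i, finExp (μ i) (g i) := by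
  rw [finExp_sum]
  exact Finset.sum_congr rfl fun i _ => finExp_pmfPi_eval μ i (g i)

theorem pmfPi_bind [DecidableEq ι] (μ : ∀ i, PMF (α i)) (κ : ∀ i, α i → PMF (β i)) :
    (pmfPi μ).bind (fun a => pmfPi fun i => κ i (a i)) = pmfPi fun i => (μ i).bind (κ i) := by
  ext b
  simp only [PMF.bind_apply, pmfPi_apply, tsum_fintype, ← Finset.prod_mul_distrib]
  rw [Finset.prod_univ_sum, Fintype.piFinset_univ]

theorem pmfPi_pure (a : ∀ i, α i) : pmfPi (fun i => PMF.pure (a i)) = PMF.pure a := by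
  classical
  ext b
  rw [pmfPi_apply, PMF.pure_apply]
  simp only [PMF.pure_apply]
  split_ifs with h
  · simp [h]
  · obtain ⟨i, hi⟩ := Function.ne_iff.1 h
    exact Finset.prod_eq_zero (Finset.mem_univ i) (by simp [hi])

theorem pmfPi_map [DecidableEq ι] (μ : ∀ i, PMF (α i)) (h : ∀ i, α i → β i) :
    (pmfPi μ).map (fun a i => h i (a i)) = pmfPi fun i => (μ i).map (h i) := by
  simp only [PMF.map]
  rw [← pmfPi_bind]
  congr 1
  ext1 a
  exact (pmfPi_pure _).symm

theorem pmfPi_comm [DecidableEq ι] {κ : Type} [Fintype κ] [DecidableEq κ] {Y : κ → Type} [∀ j, Fintype (Y j)]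
    (μ : ι → ∀ j, PMF (Y j)) :
    (pmfPi fun i => pmfPi fun j => μ i j).map (fun y j i => y i j) =
      pmfPi fun j => pmfPi fun i => μ i j := by
  ext v
  rw [PMF.map_apply, tsum_eq_single (fun i j => v j i)]
  · simp only [if_true, pmfPi_apply]
    exact Finset.prod_comm
  · intro y hy
    rw [if_neg]
    rintro rfl
    exact hy rfl

end pmfPi

/-! ### The view of a protocol with independent messages -/

/-- The law of a tuple whose entries are permuted uniformly at random. -/
def shuffled {n : ℕ} {K : Type} (μ : PMF (Fin n → K)) : PMF (Fin n → K) :=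
  μ.bind fun y => (PMF.uniformOfFintype (Equiv.Perm (Fin n))).map fun σ i => y (σ i)

theorem finExp_shuffled {n : ℕ} {K : Type} [Fintype K] (μ : PMF (Fin n → K))
    (f : (Fin n → K) → ℝ) :
    finExp (shuffled μ) f = finExp μ fun y =>
      finExp (PMF.uniformOfFintype (Equiv.Perm (Fin n))) fun σ => f fun i => y (σ i) := by
  simp only [shuffled, finExp_bind, finExp_map]

/-- If the messages of every user are independent, so are the outputs of the shufflers. -/
theorem ShuffleProtocol.view_eq_pmfPi {n m : ℕ} {X O : Type} {Y : Fin m → Type}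
    [∀ j, Fintype (Y j)] (P : ShuffleProtocol n m X Y O) (R : X → ∀ j, PMF (Y j))
    (hR : ∀ x, P.randomizer x = pmfPi (R x)) (x : Fin n → X) :
    P.view x = pmfPi fun j => shuffled (K := Y j) (pmfPi fun i => R (x i) j) := by
  simp only [shuffled]
  rw [← pmfPi_bind, ← pmfPi_comm, PMF.bind_map, ShuffleProtocol.view]
  simp only [hR]
  congr 1
  ext1 y
  exact pmfPi_map (fun _ : Fin m => PMF.uniformOfFintype (Equiv.Perm (Fin n)))
    (fun j σ i => y (σ i) j)

/-! ### Composition -/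

/-- One-sided `(ε, δ)`-indistinguishability of two laws. -/
def DPClose {α : Type} [Fintype α] (μ ν : PMF α) (ε δ : ℝ) : Prop :=
  ∀ E : Set α, finExp μ (E.indicator 1) - Real.exp ε * finExp ν (E.indicator 1) ≤ δ

/-- The part of a law that is dominated by `exp ε` times another law. -/
def dominatedPart {α : Type} (μ ν : PMF α) (ε : ℝ) (a : α) : ℝ :=
  min (μ a).toReal (Real.exp ε * (ν a).toReal)

theorem dominatedPart_nonneg {α : Type} (μ ν : PMF α) (ε : ℝ) (a : α) : 0 ≤ dominatedPart μ ν ε a :=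
  le_min ENNReal.toReal_nonneg (mul_nonneg (Real.exp_pos _).le ENNReal.toReal_nonneg)

section composition

variable {α : Type} [Fintype α]

/-- The mass of `μ` above `exp ε * ν` is the privacy defect of the worst event, the one on which `μ`
is at least `exp ε * ν`. -/
theorem DPClose.one_sub_sum_dominatedPart_le {μ ν : PMF α} {ε δ : ℝ} (h : DPClose μ ν ε δ) :
    1 - ∑ a, dominatedPart μ ν ε a ≤ δ := by
  classical
  refine le_trans (le_of_eq ?_) (h {a | Real.exp ε * (ν a).toReal ≤ (μ a).toReal})
  rw [← pmf_sum_toReal μ, ← Finset.sum_sub_distrib, finExp, finExp, Finset.mul_sum,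
    ← Finset.sum_sub_distrib]
  refine Finset.sum_congr rfl fun a _ => ?_
  by_cases ha : Real.exp ε * (ν a).toReal ≤ (μ a).toReal
  · simp [dominatedPart, ha]
  · simp [dominatedPart, ha, (not_le.1 ha).le]

theorem sum_dominatedPart_le_one (μ ν : PMF α) (ε : ℝ) : ∑ a, dominatedPart μ ν ε a ≤ 1 := by
  rw [← pmf_sum_toReal μ]
  exact Finset.sum_le_sum fun a _ => min_le_left _ _

theorem sum_dominatedPart_nonneg (μ ν : PMF α) (ε : ℝ) : 0 ≤ ∑ a, dominatedPart μ ν ε a :=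
  Finset.sum_nonneg fun a _ => dominatedPart_nonneg μ ν ε a

/-- A union bound; it is what makes the `δ`s add up under composition. -/
theorem one_sub_prod_le_sum {ι : Type} (s : Finset ι) (f : ι → ℝ) (h0 : ∀ i, 0 ≤ f i)
    (h1 : ∀ i, f i ≤ 1) : 1 - ∏ i ∈ s, f i ≤ ∑ i ∈ s, (1 - f i) := by
  classical
  induction s using Finset.induction_on with
  | empty => simp
  | insert i s hi ih =>
    rw [Finset.prod_insert hi, Finset.sum_insert hi]
    have h2 : ∏ i ∈ s, f i ≤ 1 := Finset.prod_le_one (fun i _ => h0 i) fun i _ => h1 i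
    nlinarith [h0 i, h1 i]

/-- Basic composition of independent mechanisms. -/
theorem DPClose.pmfPi {ι : Type} [Fintype ι] [DecidableEq ι] {α : ι → Type} [∀ i, Fintype (α i)]
    {μ ν : ∀ i, PMF (α i)} {ε δ : ι → ℝ} (h : ∀ i, DPClose (μ i) (ν i) (ε i) (δ i)) :
    DPClose (pmfPi μ) (pmfPi ν) (∑ i, ε i) (∑ i, δ i) := by
  classical
  intro E
  -- The product of the dominated parts lies below both `pmfPi μ` and `exp (∑ ε)` times `pmfPi ν`,
  -- so the defect of any event is at most the mass that this product lacks.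
  have hsum : 1 - ∑ a : ∀ i, α i, ∏ i, dominatedPart (μ i) (ν i) (ε i) (a i) ≤ ∑ i, δ i := by
    have h1 := Finset.prod_univ_sum (fun i => (Finset.univ : Finset (α i)))
      fun i a => dominatedPart (μ i) (ν i) (ε i) a
    rw [Fintype.piFinset_univ] at h1
    rw [← h1]
    refine (one_sub_prod_le_sum _ _ (fun i => sum_dominatedPart_nonneg _ _ _)
      fun i => sum_dominatedPart_le_one _ _ _).trans ?_
    exact Finset.sum_le_sum fun i _ => (h i).one_sub_sum_dominatedPart_le
  refine le_trans ?_ hsum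
  rw [← pmf_sum_toReal (_root_.pmfPi μ), ← Finset.sum_sub_distrib, finExp, finExp,
    Finset.mul_sum, ← Finset.sum_sub_distrib]
  refine Finset.sum_le_sum fun a _ => ?_
  have hμ : ∏ i, dominatedPart (μ i) (ν i) (ε i) (a i) ≤ (_root_.pmfPi μ a).toReal := by
    rw [pmfPi_apply, ENNReal.toReal_prod]
    exact Finset.prod_le_prod (fun i _ => dominatedPart_nonneg _ _ _ _)
      fun i _ => min_le_left _ _
  have hν : ∏ i, dominatedPart (μ i) (ν i) (ε i) (a i) ≤
      Real.exp (∑ i, ε i) * (_root_.pmfPi ν a).toReal := by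
    rw [pmfPi_apply, ENNReal.toReal_prod, Real.exp_sum, ← Finset.prod_mul_distrib]
    exact Finset.prod_le_prod (fun i _ => dominatedPart_nonneg _ _ _ _)
      fun i _ => min_le_right _ _
  by_cases ha : a ∈ E
  · simp only [Set.indicator_of_mem ha, Pi.one_apply, mul_one]
    linarith
  · simp only [Set.indicator_of_notMem ha, mul_zero]
    linarith

end composition

/-! ### The privacy blanket -/

section blanket

variable {ι K : Type} [Fintype ι]

/-- The weight of a pair `(y, b)`: the message `y` is blanket noise if `b` is true, and noise has
weight `c` for each message. -/
def blanketWeight (c : ℝ) (r : K → ℝ) (z : K × Bool) : ℝ := if z.2 then c else r z.1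

/-- The number of users who send the message `a` as blanket noise. -/
def blanketCount [DecidableEq K] (a : K) (z : ι → K × Bool) : ℝ := ∑ t, if z t = (a, true) then 1 else 0

/-- The number of users who send blanket noise. -/
def blanketSize (z : ι → K × Bool) : ℝ := ∑ t, if (z t).2 then 1 else 0

theorem blanketCount_nonneg [DecidableEq K] (a : K) (z : ι → K × Bool) : 0 ≤ blanketCount a z :=
  Finset.sum_nonneg fun _ _ => by split_ifs <;> norm_num

theorem blanketSize_nonneg (z : ι → K × Bool) : 0 ≤ blanketSize z :=
  Finset.sum_nonneg fun _ _ => by split_ifs <;> norm_num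

theorem blanketSize_pos {z : ι → K × Bool} {i : ι} (h : (z i).2 = true) : 0 < blanketSize z := by
  refine Finset.sum_pos' (fun _ _ => by split_ifs <;> norm_num) ⟨i, Finset.mem_univ i, ?_⟩
  simp [h]

theorem blanketCount_comp [DecidableEq K] (a : K) (z : ι → K × Bool) (σ : Equiv.Perm ι) :
    blanketCount a (z ∘ σ) = blanketCount a z :=
  Equiv.sum_comp σ fun t => if z t = (a, true) then (1 : ℝ) else 0

theorem blanketSize_comp (z : ι → K × Bool) (σ : Equiv.Perm ι) :
    blanketSize (z ∘ σ) = blanketSize z :=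
  Equiv.sum_comp σ fun t => if (z t).2 then (1 : ℝ) else 0

variable [DecidableEq ι]

/-- The weight of a noisy entry depends only on its position, not on its message, so exchanging two
noisy entries is invisible. -/
theorem prod_blanketWeight_swap (c : ι → ℝ) (r : ι → K → ℝ) (z : ι → K × Bool) {i t : ι}
    (hi : (z i).2 = true) (ht : (z t).2 = true) :
    ∏ k, blanketWeight (c k) (r k) ((z ∘ Equiv.swap i t) k) =
      ∏ k, blanketWeight (c k) (r k) (z k) := by
  refine Finset.prod_congr rfl fun k _ => ?_
  by_cases hki : k = i
  · subst hki
    simp [blanketWeight, hi, ht]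
  · by_cases hkt : k = t
    · subst hkt
      simp [blanketWeight, hi, ht]
    · simp [Equiv.swap_apply_of_ne_of_ne hki hkt]

variable [Fintype K] [DecidableEq K]

/-- A user `i` who always sends blanket noise can be exchanged with every other user who does. -/
theorem sum_blanketWeight_symm (c : ι → ℝ) (r : ι → K → ℝ) (i : ι) (hr : ∀ y, r i y = 0) (a : K)
    (H : (ι → K × Bool) → ℝ) (hH : ∀ z t, H (z ∘ Equiv.swap i t) = H z) :
    ∑ z : ι → K × Bool, (∏ k, blanketWeight (c k) (r k) (z k)) *
        ((if (z i).1 = a then 1 else 0) * H z) =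
      ∑ z : ι → K × Bool, (∏ k, blanketWeight (c k) (r k) (z k)) *
        (blanketCount a z / blanketSize z * H z) := by
  -- Only configurations in which user `i` is noisy carry weight; in particular `blanketSize` is
  -- then positive.
  have hz : ∀ z : ι → K × Bool, (z i).2 = false →
      ∏ k, blanketWeight (c k) (r k) (z k) = 0 := fun z h =>
    Finset.prod_eq_zero (Finset.mem_univ i) (by simp [blanketWeight, h, hr])
  -- Double counting: `T` shares the term of `z` equally among the noisy users `t`. Summing over `t`
  -- recovers the left side; swapping `i` with `t` first makes `t` the user who sends `a`, which
  -- counts `blanketCount a`.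
  let T : ι → (ι → K × Bool) → ℝ := fun t z => (∏ k, blanketWeight (c k) (r k) (z k)) *
    ((if (z t).2 then 1 else 0) * (if (z i).1 = a then 1 else 0) * H z / blanketSize z)
  have h1 : ∀ z : ι → K × Bool, (∏ k, blanketWeight (c k) (r k) (z k)) *
      ((if (z i).1 = a then 1 else 0) * H z) = ∑ t, T t z := by
    intro z
    simp only [T]
    rw [← Finset.mul_sum]
    rcases hb : (z i).2 with _ | _
    · rw [hz z hb, zero_mul, zero_mul]
    · congr 1
      rw [← Finset.sum_div, ← Finset.sum_mul, ← Finset.sum_mul]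
      change _ = blanketSize z * _ * _ / _
      have := (blanketSize_pos hb).ne'
      field_simp
  have h2 : ∀ z : ι → K × Bool, (∏ k, blanketWeight (c k) (r k) (z k)) *
        (blanketCount a z / blanketSize z * H z) = ∑ t, T t (z ∘ Equiv.swap i t) := by
    intro z
    rw [blanketCount, Finset.sum_div, Finset.sum_mul, Finset.mul_sum]
    refine Finset.sum_congr rfl fun t _ => ?_
    simp only [T, hH, blanketSize_comp, Function.comp_apply, Equiv.swap_apply_left,
      Equiv.swap_apply_right]
    rcases hb : (z i).2 with _ | _
    · simp [hz z hb]
    · by_cases hta : z t = (a, true)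
      · have ht : (z t).2 = true := by rw [hta]
        have hp := prod_blanketWeight_swap c r z hb ht
        simp only [Function.comp_apply] at hp
        rw [hp, hta]
        simp only [if_true]
        ring
      · rcases ht : (z t).2 with _ | _
        · have h0 := hz (z ∘ Equiv.swap i t) (by simpa using ht)
          simp only [Function.comp_apply] at h0
          simp [h0, hta]
        · have : (z t).1 ≠ a := fun h => hta (Prod.ext h ht)
          simp [hta, this]
  simp only [h1, h2]
  rw [Finset.sum_comm, Finset.sum_comm (s := Finset.univ (α := ι → K × Bool))]
  exact Finset.sum_congr rfl fun t _ =>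
    (Equiv.sum_comp (Equiv.arrowCongr (Equiv.swap i t) (Equiv.refl (K × Bool))) (T t)).symm

/-- The exponential moment of the counts of two messages in the blanket. -/
theorem sum_blanketWeight_exp (c : ℝ) (r : ι → K → ℝ) (i : ι) {a a' : K} (haa' : a ≠ a')
    (hr : ∀ k, k ≠ i → Fintype.card K * c + ∑ y, r k y = 1) (u v : ℝ) :
    ∑ z : ι → K × Bool,
        (∏ k, blanketWeight (if k = i then 1 else c) (if k = i then 0 else r k) (z k)) *
        ((if (z i).1 = a then 1 else 0) *
          Real.exp (u * blanketCount a z - v * blanketCount a' z)) =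
      Real.exp u * (1 + c * (Real.exp u + Real.exp (-v) - 2)) ^ (Fintype.card ι - 1) := by
  -- The counts are sums over users, so the exponential splits into one factor `g` per user. User
  -- `i` is forced to send `a` and gives `exp u`; every other user gives the same factor.
  let g : K × Bool → ℝ := fun w =>
    Real.exp (u * (if w = (a, true) then 1 else 0) - v * (if w = (a', true) then 1 else 0))
  let F : ι → K × Bool → ℝ := fun k w =>
    blanketWeight (if k = i then 1 else c) (if k = i then 0 else r k) w *
      ((if k = i then (if w.1 = a then 1 else 0) else 1) * g w)
  have h1 : ∀ z : ι → K × Bool,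
      (∏ k, blanketWeight (if k = i then 1 else c) (if k = i then 0 else r k) (z k)) *
        ((if (z i).1 = a then 1 else 0) *
          Real.exp (u * blanketCount a z - v * blanketCount a' z)) = ∏ k, F k (z k) := by
    intro z
    simp only [F, Finset.prod_mul_distrib, g, ← Real.exp_sum, blanketCount, Finset.mul_sum,
      Finset.sum_sub_distrib]
    congr 2
    rw [Finset.prod_ite_eq' Finset.univ i]
    simp
  have hprod := Finset.prod_univ_sum (fun _ : ι => (Finset.univ : Finset (K × Bool))) F
  rw [Fintype.piFinset_univ] at hprod
  simp only [h1]
  rw [← hprod, ← Finset.mul_prod_erase _ _ (Finset.mem_univ i)]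
  have hg : ∀ y, g (y, true) = 1 + (if y = a then Real.exp u - 1 else 0) +
      (if y = a' then Real.exp (-v) - 1 else 0) := by
    intro y
    by_cases hy : y = a
    · subst hy
      simp [g, haa']
    · by_cases hy' : y = a' <;> simp [g, hy, hy', haa'.symm]
  have hg' : ∀ y, g (y, false) = 1 := fun y => by simp [g]
  congr 1
  · rw [Fintype.sum_prod_type]
    simp only [Fintype.sum_bool, F, if_true, blanketWeight, Pi.zero_apply, ite_mul, one_mul,
      zero_mul, Bool.false_eq_true, if_false, add_zero]
    rw [Finset.sum_ite_eq' Finset.univ a]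
    simp [hg, haa']
  · rw [Finset.prod_congr rfl (g := fun _ => 1 + c * (Real.exp u + Real.exp (-v) - 2)),
      Finset.prod_const, Finset.card_erase_of_mem (Finset.mem_univ i), Finset.card_univ]
    intro k hk
    have hki := Finset.ne_of_mem_erase hk
    rw [Fintype.sum_prod_type]
    simp only [Fintype.sum_bool, F, hki, if_false, blanketWeight, if_true, one_mul,
      Bool.false_eq_true, hg, hg', mul_one, mul_add, Finset.sum_add_distrib, mul_ite, mul_zero]
    rw [Finset.sum_ite_eq' Finset.univ a, Finset.sum_ite_eq' Finset.univ a']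
    have := hr k hki
    simp only [Finset.sum_const, Finset.card_univ, nsmul_eq_mul, Finset.mem_univ, if_true]
    linarith

end blanket

section blanket

variable {ι K : Type} [Fintype ι] [DecidableEq ι]

theorem prod_blanketWeight_nonneg {c : ℝ} {r : ι → K → ℝ} (i : ι) (hc : 0 ≤ c)
    (hr0 : ∀ k y, 0 ≤ r k y) (z : ι → K × Bool) :
    0 ≤ ∏ k, blanketWeight (if k = i then 1 else c) (if k = i then 0 else r k) (z k) := by
  refine Finset.prod_nonneg fun k _ => ?_
  unfold blanketWeight
  split_ifs
  · exact zero_le_one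
  · exact hc
  · exact le_rfl
  · exact hr0 k _

variable [Fintype K] [DecidableEq K]

/-- The total weight of the blankets in which user `i` sends `a`, weighted by `G`. -/
def blanketSum (c : ℝ) (r : ι → K → ℝ) (i : ι) (G : (ι → K) → ℝ) (a : K) : ℝ :=
  ∑ z : ι → K × Bool,
    (∏ k, blanketWeight (if k = i then 1 else c) (if k = i then 0 else r k) (z k)) *
      ((if (z i).1 = a then 1 else 0) * G fun k => (z k).1)

theorem blanketSum_nonneg {c : ℝ} {r : ι → K → ℝ} (i : ι) (hc : 0 ≤ c)
    (hr0 : ∀ k y, 0 ≤ r k y) {G : (ι → K) → ℝ} (hG0 : ∀ y, 0 ≤ G y) (a : K) :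
    0 ≤ blanketSum c r i G a :=
  Finset.sum_nonneg fun z _ => mul_nonneg (prod_blanketWeight_nonneg i hc hr0 z)
    (mul_nonneg (by split_ifs <;> norm_num) (hG0 _))

/-- A Chernoff bound that avoids conditioning on the number of noisy users: the ratio `N /
blanketSize` is kept inside the sum, because the exchange lemma converts it back to the indicator
that user `i` sends `a`, after which the moment is a product. -/
theorem blanketSum_sub_le {c : ℝ} {r : ι → K → ℝ} (i : ι) {a a' : K} (haa' : a ≠ a') (hc : 0 ≤ c)
    (hr0 : ∀ k y, 0 ≤ r k y)
    (hr : ∀ k, k ≠ i → Fintype.card K * c + ∑ y, r k y = 1) {G : (ι → K) → ℝ}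
    (hG0 : ∀ y, 0 ≤ G y) (hG1 : ∀ y, G y ≤ 1) (hG : ∀ y (σ : Equiv.Perm ι), G (y ∘ σ) = G y)
    {ε t : ℝ} (ht : 0 ≤ t) :
    blanketSum c r i G a - Real.exp ε * blanketSum c r i G a' ≤
      Real.exp t *
        (1 + c * (Real.exp t + Real.exp (-(t * Real.exp ε)) - 2)) ^ (Fintype.card ι - 1) := by
  have symm := fun (a : K) (H : (ι → K × Bool) → ℝ) => sum_blanketWeight_symm
    (fun k => if k = i then 1 else c) (fun k => if k = i then 0 else r k) i (by simp) a H
  rw [← sum_blanketWeight_exp c r i haa' hr t (t * Real.exp ε), blanketSum, blanketSum]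
  -- The first two exchanges act on the two blanket sums, the third on the exponential moment on the
  -- right.
  rw [symm a, symm a', symm a, Finset.mul_sum, ← Finset.sum_sub_distrib]
  rotate_left
  · intro z t'
    rw [blanketCount_comp, blanketCount_comp]
  · exact fun z t' => hG (fun k => (z k).1) _
  · exact fun z t' => hG (fun k => (z k).1) _
  refine Finset.sum_le_sum fun z _ => ?_
  have hμ := prod_blanketWeight_nonneg i hc hr0 z
  set μ := ∏ k, blanketWeight (if k = i then 1 else c) (if k = i then 0 else r k) (z k)
  set g := G fun k => (z k).1
  have hg0 : 0 ≤ g := hG0 _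
  have hg1 : g ≤ 1 := hG1 _
  have hN := blanketCount_nonneg a z
  have hN' := blanketCount_nonneg a' z
  set N := blanketCount a z
  set N' := blanketCount a' z
  have key : (N - Real.exp ε * N') * g ≤ N * Real.exp (t * N - t * Real.exp ε * N') := by
    have he := (Real.exp_pos ε).le
    rcases le_total (N - Real.exp ε * N') 0 with h | h
    · exact (mul_nonpos_of_nonpos_of_nonneg h hg0).trans (mul_nonneg hN (Real.exp_pos _).le)
    · have h1 : 1 ≤ Real.exp (t * N - t * Real.exp ε * N') := by
        rw [Real.one_le_exp_iff]
        have := mul_nonneg ht h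
        linarith
      calc (N - Real.exp ε * N') * g ≤ (N - Real.exp ε * N') * 1 :=
            mul_le_mul_of_nonneg_left hg1 h
        _ ≤ N * 1 := by nlinarith
        _ ≤ _ := mul_le_mul_of_nonneg_left h1 hN
  calc μ * (N / blanketSize z * g) - Real.exp ε * (μ * (N' / blanketSize z * g))
      = μ * (((N - Real.exp ε * N') * g) / blanketSize z) := by ring
    _ ≤ μ * ((N * Real.exp (t * N - t * Real.exp ε * N')) / blanketSize z) :=
        mul_le_mul_of_nonneg_left (div_le_div_of_nonneg_right key (blanketSize_nonneg z)) hμ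
    _ = _ := by ring

/-- The sum over all messages, organized by the message of user `i`. -/
theorem sum_prod_eq_sum_blanketSum (c : ℝ) (r : ι → K → ℝ) (i : ι) (w : K → ℝ)
    (G : (ι → K) → ℝ) :
    ∑ y : ι → K, (∏ k, if k = i then w (y k) else c + r k (y k)) * G y =
      ∑ a, w a * blanketSum c r i G a := by
  simp only [blanketSum, Finset.mul_sum]
  rw [Finset.sum_comm, ← Equiv.sum_comp (Equiv.arrowProdEquivProdArrow ι (fun _ => K)
    (fun _ => Bool)).symm, Fintype.sum_prod_type]
  refine Finset.sum_congr rfl fun y _ => ?_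
  have h1 : ∀ b : ι → Bool, (∑ a, w a * ((∏ k, blanketWeight (if k = i then 1 else c)
      (if k = i then 0 else r k) (y k, b k)) * ((if y i = a then 1 else 0) * G y))) =
      (∏ k, blanketWeight (if k = i then 1 else c) (if k = i then 0 else r k) (y k, b k)) *
        (w (y i) * G y) := by
    intro b
    rw [Finset.sum_eq_single (y i) (fun a _ ha => by simp [ha.symm]) (by simp)]
    simp only [if_true]
    ring
  -- Summing over the noise flags multiplies out: a user `k ≠ i` gives `c + r k (y k)`, and user `i`
  -- gives `1 + 0`.
  have h2 := Finset.prod_univ_sum (fun _ : ι => (Finset.univ : Finset Bool)) fun k b =>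
    blanketWeight (if k = i then 1 else c) (if k = i then 0 else r k) (y k, b)
  rw [Fintype.piFinset_univ] at h2
  refine Eq.trans ?_ (Finset.sum_congr rfl fun b _ => h1 b).symm
  rw [← Finset.sum_mul, ← h2, ← Finset.mul_prod_erase _ _ (Finset.mem_univ i),
    ← Finset.mul_prod_erase _ _ (Finset.mem_univ i)]
  have h3 : ∏ k ∈ Finset.univ.erase i, (if k = i then w (y k) else c + r k (y k)) =
      ∏ k ∈ Finset.univ.erase i, ∑ b, blanketWeight (if k = i then 1 else c)
        (if k = i then 0 else r k) (y k, b) := by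
    refine Finset.prod_congr rfl fun k hk => ?_
    simp [blanketWeight, Finset.ne_of_mem_erase hk]
  rw [h3]
  simp [blanketWeight]
  ring

/-- The noise part is common to both inputs and contributes at most `0` since `exp ε ≥ 1`. What
remains is an average of `A a - exp ε * A a'` over independent `a` and `a'` with laws `ρ` and `ρ'`.
-/
theorem blanketSum_mixture_sub_le {A : K → ℝ} (hA : ∀ a, 0 ≤ A a) {ε η : ℝ} (hε : 0 ≤ ε)
    (hη : 0 ≤ η) (h : ∀ a a', a ≠ a' → A a - Real.exp ε * A a' ≤ η) {c γ : ℝ} (hc : 0 ≤ c)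
    (hγ0 : 0 ≤ γ) (hγ1 : γ ≤ 1) {ρ ρ' : K → ℝ} (hρ0 : ∀ a, 0 ≤ ρ a) (hρ0' : ∀ a, 0 ≤ ρ' a)
    (hρ : ∑ a, ρ a = 1) (hρ' : ∑ a, ρ' a = 1) :
    ∑ a, (c + (1 - γ) * ρ a) * A a - Real.exp ε * ∑ a, (c + (1 - γ) * ρ' a) * A a ≤ η := by
  have he : 1 ≤ Real.exp ε := Real.one_le_exp hε
  have h' : ∀ a a', A a - Real.exp ε * A a' ≤ η := by
    intro a a'
    by_cases haa : a = a'
    · subst haa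
      nlinarith [hA a]
    · exact h a a' haa
  have h1 : ∑ a, ρ a * A a - Real.exp ε * ∑ a, ρ' a * A a ≤ η := by
    have h2 : ∑ a, ρ a * A a - Real.exp ε * ∑ a, ρ' a * A a =
        ∑ a, ∑ a', ρ a * ρ' a' * (A a - Real.exp ε * A a') := by
      have e1 : ∑ a, ρ a * A a = ∑ a, ∑ a', ρ a * ρ' a' * A a := by
        refine Finset.sum_congr rfl fun a _ => ?_
        rw [← Finset.sum_mul, ← Finset.mul_sum, hρ', mul_one]
      have e2 : ∑ a, ρ' a * A a = ∑ a, ∑ a', ρ a * ρ' a' * A a' := by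
        rw [Finset.sum_comm]
        refine Finset.sum_congr rfl fun a _ => ?_
        rw [← Finset.sum_mul, ← Finset.sum_mul, hρ, one_mul]
      rw [e1, e2, Finset.mul_sum, ← Finset.sum_sub_distrib]
      refine Finset.sum_congr rfl fun a _ => ?_
      rw [Finset.mul_sum, ← Finset.sum_sub_distrib]
      exact Finset.sum_congr rfl fun a' _ => by ring
    rw [h2]
    calc ∑ a, ∑ a', ρ a * ρ' a' * (A a - Real.exp ε * A a')
        ≤ ∑ a, ∑ a', ρ a * ρ' a' * η := Finset.sum_le_sum fun a _ => Finset.sum_le_sum fun a' _ =>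
          mul_le_mul_of_nonneg_left (h' a a') (mul_nonneg (hρ0 a) (hρ0' a'))
      _ = η := by
        simp only [← Finset.sum_mul, ← Finset.mul_sum, hρ, hρ', one_mul, mul_one]
  have h3 : ∀ ρ : K → ℝ, ∑ a, (c + (1 - γ) * ρ a) * A a =
      c * ∑ a, A a + (1 - γ) * ∑ a, ρ a * A a := by
    intro ρ
    rw [Finset.mul_sum, Finset.mul_sum, ← Finset.sum_add_distrib]
    exact Finset.sum_congr rfl fun a _ => by ring
  have h4 : 0 ≤ c * ∑ a, A a := mul_nonneg hc (Finset.sum_nonneg fun a _ => hA a)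
  rw [h3, h3]
  nlinarith [mul_le_mul_of_nonneg_left h1 (sub_nonneg.2 hγ1)]

end blanket

/-- The moment bound for the blanket, optimized for `ε ≤ 1`. -/
theorem exp_add_exp_neg_sub_two_le {ε : ℝ} (h0 : 0 ≤ ε) (h1 : ε ≤ 1) :
    Real.exp (ε / 4) + Real.exp (-(ε / 4 * Real.exp ε)) - 2 ≤ -(ε ^ 2 / 7) := by
  -- With `t = ε / 4` the leading term is `-t * ε + t ^ 2 = -3 * ε ^ 2 / 16`, which leaves room for
  -- `1 / 7`. The value `t = ε / 2`, best for small `ε`, fails near `ε = 1`. Taylor bounds reduce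
  -- the claim to a polynomial inequality on `[0, 1]`.
  have he := Real.quadratic_le_exp_of_nonneg h0
  set v := ε / 4 * (1 + ε + ε ^ 2 / 2) with hv
  have hv0 : 0 ≤ v := by positivity
  have h2 : Real.exp (-(ε / 4 * Real.exp ε)) ≤ 1 / (1 + v + v ^ 2 / 2) := by
    rw [Real.exp_neg, ← one_div]
    refine one_div_le_one_div_of_le (by positivity) ?_
    refine (Real.quadratic_le_exp_of_nonneg hv0).trans (Real.exp_le_exp.2 ?_)
    exact mul_le_mul_of_nonneg_left he (by positivity)
  have h3 : Real.exp (ε / 4) ≤ 1 + ε / 4 + (ε / 4) ^ 2 * (3 / 5) := by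
    have := Real.exp_bound' (x := ε / 4) (by positivity) (by linarith) (n := 2) (by norm_num)
    norm_num [Finset.sum_range_succ, Nat.factorial] at this
    have h5 := Real.exp_bound' (x := ε / 4) (by positivity) (by linarith) (n := 3) (by norm_num)
    norm_num [Finset.sum_range_succ, Nat.factorial] at h5
    nlinarith [pow_nonneg h0 2, pow_nonneg h0 3, mul_le_mul_of_nonneg_left h1 (pow_nonneg h0 2)]
  have h4 : 1 / (1 + v + v ^ 2 / 2) ≤ 2 - ε ^ 2 / 7 - (1 + ε / 4 + (ε / 4) ^ 2 * (3 / 5)) := by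
    rw [div_le_iff₀ (by positivity), hv]
    have hk : ∀ k, ε ^ (k + 3) ≤ ε ^ 3 := fun k => pow_le_pow_of_le_one h0 h1 (by omega)
    have h23 : ε ^ 3 ≤ ε ^ 2 := pow_le_pow_of_le_one h0 h1 (by omega)
    have h4 : ε ^ 4 ≤ ε ^ 3 := hk 1
    have h5 : ε ^ 5 ≤ ε ^ 3 := hk 2
    have h6 : ε ^ 6 ≤ ε ^ 3 := hk 3
    have h7 : ε ^ 7 ≤ ε ^ 3 := hk 4
    have h8 : ε ^ 8 ≤ ε ^ 3 := hk 5
    linarith [pow_nonneg h0 3]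
  linarith

/-! ### Privacy of the recursive protocol -/

theorem pmf_toReal_eq_finExp {α : Type} [Fintype α] [DecidableEq α] (μ : PMF α) (a : α) :
    (μ a).toReal = finExp μ fun b => if b = a then 1 else 0 := by
  simp [finExp]

theorem finExp_randResponse (γ : unitInterval) (d : ℕ) (x : Fin (d + 1))
    (f : Fin (d + 1) → ℝ) :
    finExp (randResponse γ d x) f = γ * ((∑ a, f a) / (d + 1)) + (1 - γ) * f x := by
  rw [randResponse, finExp_bind, finExp_berUnit]
  simp [finExp_uniform, finExp_pure]

theorem finExp_bind_randResponse (γ : unitInterval) (d : ℕ) (ρ : PMF (Fin (d + 1)))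
    (f : Fin (d + 1) → ℝ) :
    finExp (ρ.bind (randResponse γ d)) f =
      γ * ((∑ a, f a) / (d + 1)) + (1 - γ) * finExp ρ f := by
  rw [finExp_bind]
  simp only [finExp_randResponse]
  rw [finExp_add, finExp_const]
  simp only [mul_comm (1 - (γ : ℝ))]
  rw [finExp_mul_const]

theorem bind_randResponse_toReal (γ : unitInterval) (d : ℕ) (ρ : PMF (Fin (d + 1)))
    (a : Fin (d + 1)) :
    ((ρ.bind (randResponse γ d)) a).toReal = γ / (d + 1) + (1 - γ) * (ρ a).toReal := by
  rw [pmf_toReal_eq_finExp, finExp_bind_randResponse, ← pmf_toReal_eq_finExp]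
  simp
  ring

/-- The failure probability of the privacy blanket. -/
theorem exp_mul_pow_le {n : ℕ} (hn : 1 ≤ n) {c ε δ : ℝ} (hc0 : 0 ≤ c) (hc1 : c ≤ 1)
    (h0 : 0 ≤ ε) (h1 : ε ≤ 1) (hδ : 0 < δ)
    (h : 7 * Real.log (2 / δ) ≤ ((n : ℝ) - 1) * c * ε ^ 2) :
    Real.exp (ε / 4) *
      (1 + c * (Real.exp (ε / 4) + Real.exp (-(ε / 4 * Real.exp ε)) - 2)) ^ (n - 1) ≤ δ := by
  have hg := exp_add_exp_neg_sub_two_le h0 h1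
  have hg1 : -1 ≤ Real.exp (ε / 4) + Real.exp (-(ε / 4 * Real.exp ε)) - 2 := by
    have h2 : 1 ≤ Real.exp (ε / 4) := Real.one_le_exp (by linarith)
    linarith [Real.exp_pos (-(ε / 4 * Real.exp ε))]
  set g := Real.exp (ε / 4) + Real.exp (-(ε / 4 * Real.exp ε)) - 2
  have hb : 0 ≤ 1 + c * g := by nlinarith
  have hn1 : ((n - 1 : ℕ) : ℝ) = (n : ℝ) - 1 := by push_cast [hn]; ring
  have hn0 : 0 ≤ (n : ℝ) - 1 := by rw [← hn1]; positivity
  have hpow : (1 + c * g) ^ (n - 1) ≤ Real.exp (-Real.log (2 / δ)) := by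
    calc (1 + c * g) ^ (n - 1) ≤ Real.exp (c * g) ^ (n - 1) :=
          pow_le_pow_left₀ hb (by linarith [Real.add_one_le_exp (c * g)]) _
      _ = Real.exp (((n : ℝ) - 1) * (c * g)) := by rw [← Real.exp_nat_mul, hn1]
      _ ≤ _ := by
        rw [Real.exp_le_exp]
        have := mul_le_mul_of_nonneg_left hg (mul_nonneg hn0 hc0)
        linarith
  -- This prefactor is why the logarithm is of `2 / δ` and not of `1 / δ`.
  have ht : Real.exp (ε / 4) ≤ 2 := by
    have h2 : Real.exp (ε / 4) ≤ Real.exp (1 / 4) := Real.exp_le_exp.2 (by linarith)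
    have h3 := Real.exp_bound' (x := 1 / 4) (by norm_num) (by norm_num) (n := 1) (by norm_num)
    norm_num [Finset.sum_range_succ, Nat.factorial] at h3
    linarith
  rw [Real.exp_neg, Real.exp_log (by positivity), inv_div] at hpow
  calc _ ≤ 2 * (δ / 2) := mul_le_mul ht hpow (pow_nonneg hb _) (by norm_num)
    _ = δ := by ring

/-- The probability of an event after a uniformly random permutation. -/
def shuffleProb {n : ℕ} {K : Type} (E : Set (Fin n → K)) (y : Fin n → K) : ℝ :=
  finExp (PMF.uniformOfFintype (Equiv.Perm (Fin n))) fun σ => E.indicator 1 fun i => y (σ i)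

theorem shuffleProb_nonneg {n : ℕ} {K : Type} (E : Set (Fin n → K)) (y : Fin n → K) :
    0 ≤ shuffleProb E y := by
  rw [← finExp_const (PMF.uniformOfFintype (Equiv.Perm (Fin n))) 0]
  exact finExp_mono _ fun σ => Set.indicator_nonneg (fun _ _ => zero_le_one) _

theorem shuffleProb_le_one {n : ℕ} {K : Type} (E : Set (Fin n → K)) (y : Fin n → K) :
    shuffleProb E y ≤ 1 := by
  rw [← finExp_const (PMF.uniformOfFintype (Equiv.Perm (Fin n))) 1]
  exact finExp_mono _ fun σ => Set.indicator_le_self' (fun _ _ => zero_le_one) _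

theorem shuffleProb_comp {n : ℕ} {K : Type} (E : Set (Fin n → K)) (y : Fin n → K)
    (σ : Equiv.Perm (Fin n)) : shuffleProb E (y ∘ σ) = shuffleProb E y := by
  rw [shuffleProb, shuffleProb, finExp_uniform, finExp_uniform]
  congr 1
  exact Equiv.sum_comp (Equiv.mulLeft σ) fun τ : Equiv.Perm (Fin n) =>
    E.indicator (1 : (Fin n → K) → ℝ) fun i => y (τ i)

/-- Privacy of one shuffler: randomized response, amplified by the privacy blanket. -/
theorem dpClose_shuffled {n d : ℕ} (γ : unitInterval) (ρ ρ' : Fin n → PMF (Fin (d + 1)))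
    (i : Fin n) (hρ : ∀ k, k ≠ i → ρ k = ρ' k) {ε δ : ℝ} (h0 : 0 ≤ ε) (h1 : ε ≤ 1) (hδ : 0 < δ)
    (h : 7 * Real.log (2 / δ) ≤ ((n : ℝ) - 1) * (γ / (d + 1)) * ε ^ 2) :
    DPClose (shuffled (pmfPi fun k => (ρ k).bind (randResponse γ d)))
      (shuffled (pmfPi fun k => (ρ' k).bind (randResponse γ d))) ε δ := by
  intro E
  have hγ0 : (0 : ℝ) ≤ γ := γ.2.1
  have hγ1 : (γ : ℝ) ≤ 1 := γ.2.2
  have hd : (0 : ℝ) < d + 1 := by positivity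
  set c : ℝ := γ / (d + 1) with hc
  have hc0 : 0 ≤ c := div_nonneg hγ0 hd.le
  have hc1 : c ≤ 1 := by
    rw [hc, div_le_one hd]
    linarith [(Nat.cast_nonneg d : (0 : ℝ) ≤ d)]
  -- The part of the output law that depends on the data; `r` and `c` together have total mass `1`.
  let r : Fin n → Fin (d + 1) → ℝ := fun k y => (1 - γ) * (ρ k y).toReal
  have hr0 : ∀ k y, 0 ≤ r k y := fun k y =>
    mul_nonneg (sub_nonneg.2 hγ1) ENNReal.toReal_nonneg
  have hr : ∀ k, k ≠ i → Fintype.card (Fin (d + 1)) * c + ∑ y, r k y = 1 := by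
    intro k _
    rw [← Finset.mul_sum, pmf_sum_toReal, hc, Fintype.card_fin]
    push_cast
    field_simp
    ring
  -- Both inputs share the same blanket sums, since these see only the users other than `i`; the
  -- inputs enter through the mixture weights of user `i` alone.
  have key : ∀ ρ₀ : Fin n → PMF (Fin (d + 1)), (∀ k, k ≠ i → ρ k = ρ₀ k) →
      finExp (shuffled (pmfPi fun k => (ρ₀ k).bind (randResponse γ d))) (E.indicator 1) =
      ∑ a, (c + (1 - γ) * (ρ₀ i a).toReal) * blanketSum c r i (shuffleProb E) a := by
    intro ρ₀ h₀
    rw [finExp_shuffled, ← sum_prod_eq_sum_blanketSum]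
    refine Finset.sum_congr rfl fun y _ => ?_
    rw [pmfPi_apply, ENNReal.toReal_prod]
    congr 1
    refine Finset.prod_congr rfl fun k _ => ?_
    rw [bind_randResponse_toReal]
    split_ifs with hk
    · rw [hk]
    · rw [← h₀ k hk]
  rw [key ρ fun _ _ => rfl, key ρ' hρ]
  refine blanketSum_mixture_sub_le
    (fun a => blanketSum_nonneg i hc0 hr0 (shuffleProb_nonneg E) a) h0 hδ.le ?_ hc0 hγ0 hγ1
    (fun _ => ENNReal.toReal_nonneg) (fun _ => ENNReal.toReal_nonneg)
    (pmf_sum_toReal _) (pmf_sum_toReal _)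
  intro a a' haa'
  refine (blanketSum_sub_le i haa' hc0 hr0 hr (shuffleProb_nonneg E) (shuffleProb_le_one E)
    (shuffleProb_comp E) (t := ε / 4) (by linarith)).trans ?_
  rw [Fintype.card_fin]
  exact exp_mul_pow_le (Nat.one_le_of_lt i.2) hc0 hc1 h0 h1 hδ h

theorem log_two_div_nonneg {m : ℕ} (hm : 1 ≤ m) {δ : ℝ} (hδ : 0 < δ) (hδ1 : δ ≤ 1) :
    0 ≤ Real.log (2 / (δ / m)) := by
  have hm' : (1 : ℝ) ≤ m := by exact_mod_cast hm
  refine Real.log_nonneg ?_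
  rw [le_div_iff₀ (by positivity), one_mul, div_le_iff₀ (by positivity)]
  linarith

/-- The recursive protocol is differentially private. -/
theorem recProtocol_isDP {n m : ℕ} (hn : 2 ≤ n) (hm : 1 ≤ m) {ε δ : ℝ} (h0 : 0 < ε) (h1 : ε ≤ m)
    (hδ : 0 < δ) (hδ1 : δ ≤ 1) (p : Fin m → ℕ) (γ : Fin m → unitInterval) (hp : ∀ j, 1 ≤ p j)
    (hγ : ∀ j, (γ j : ℝ) = recGamma n ε δ p j) : (recProtocol n p γ).IsDP ε δ := by
  intro x x' ⟨i, hi⟩ E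
  have hm0 : (0 : ℝ) < m := by exact_mod_cast hm
  have hview := fun x => (recProtocol n p γ).view_eq_pmfPi
    (fun x j => (roundedDigit p x j).bind (randResponse (γ j) (msgRange p j))) (fun _ => rfl) x
  rw [toOuterMeasure_toReal, toOuterMeasure_toReal, hview, hview]
  have hsum : ∀ a : ℝ, ∑ _j : Fin m, a / m = a := by
    intro a
    rw [Finset.sum_const, Finset.card_univ, Fintype.card_fin, nsmul_eq_mul]
    field_simp
  have := DPClose.pmfPi (ε := fun _ => ε / m) (δ := fun _ => δ / m) fun j =>
    dpClose_shuffled (γ j) (fun k => roundedDigit p (x k) j) (fun k => roundedDigit p (x' k) j) i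
      (fun k hk => by rw [hi k hk]) (ε := ε / m) (δ := δ / m) (by positivity)
      ((div_le_one hm0).2 h1) (by positivity) (by
        have hn1 : (0 : ℝ) < (n : ℝ) - 1 := by
          have : (2 : ℝ) ≤ n := by exact_mod_cast hn
          linarith
        have hd : (1 : ℝ) ≤ msgRange p j := by
          have := hp j
          exact_mod_cast (by unfold msgRange; omega : 1 ≤ msgRange p j)
        have hL := log_two_div_nonneg hm hδ hδ1
        have hd' : (p j : ℝ) + (lastInd j : ℝ) = msgRange p j := by simp [msgRange]
        rw [hγ, recGamma, hd']
        have : ((n : ℝ) - 1) * (14 * (msgRange p j : ℝ) * Real.log (2 / (δ / m)) /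
            (((n : ℝ) - 1) * (ε / m) ^ 2) / (msgRange p j + 1)) * (ε / m) ^ 2 =
            14 * (msgRange p j : ℝ) * Real.log (2 / (δ / m)) / (msgRange p j + 1) := by
          have : (ε / m) ≠ 0 := by positivity
          field_simp
        -- The constant `14` is twice the required `7`, because `d / (d + 1) ≥ 1 / 2` for `d ≥ 1`.
        rw [this, le_div_iff₀ (by positivity)]
        nlinarith)
  rw [hsum, hsum] at this
  exact this E

/-! ### The error of the recursive protocol -/

theorem lintegral_map_toMeasure {α : Type} [Fintype α] (μ : PMF α) (f : α → ℝ) {g : ℝ → ℝ}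
    (hg : Measurable g) (hg0 : ∀ z, 0 ≤ g z) :
    ∫⁻ z, ENNReal.ofReal (g z) ∂(μ.map f).toMeasure =
      ENNReal.ofReal (finExp μ fun a => g (f a)) := by
  let _ : MeasurableSpace α := ⊤
  have : MeasurableSingletonClass α := ⟨fun _ => trivial⟩
  have hf : Measurable f := measurable_from_top
  rw [← PMF.toMeasure_map f μ hf, MeasureTheory.lintegral_map hg.ennreal_ofReal hf,
    MeasureTheory.lintegral_fintype, finExp, ENNReal.ofReal_sum_of_nonneg]
  · refine Finset.sum_congr rfl fun a _ => ?_
    rw [PMF.toMeasure_apply_singleton _ _ (MeasurableSet.singleton a), ENNReal.ofReal_mul ENNReal.toReal_nonneg,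
      ENNReal.ofReal_toReal (μ.apply_ne_top a), mul_comm]
  · exact fun a _ => mul_nonneg ENNReal.toReal_nonneg (hg0 _)

theorem ShuffleProtocol.MSE_le {n m : ℕ} {Y : Fin m → Type} [∀ j, Fintype (Y j)]
    (P : ShuffleProtocol n m unitInterval Y ℝ) {B : ℝ}
    (h : ∀ x : Fin n → unitInterval,
      finExp (P.view x) (fun v => (P.analyzer v - ∑ i, (x i : ℝ)) ^ 2) ≤ B) :
    P.MSE ≤ ENNReal.ofReal B := by
  refine iSup_le fun x => ?_
  rw [ShuffleProtocol.mechanism, lintegral_map_toMeasure _ _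
    (g := fun z => (z - ∑ i, (x i : ℝ)) ^ 2) (by fun_prop) fun _ => sq_nonneg _]
  exact ENNReal.ofReal_le_ofReal (h x)

/-- The shufflers do not affect statistics that are invariant under permutations. -/
theorem ShuffleProtocol.finExp_view {n m : ℕ} {X O : Type} {Y : Fin m → Type}
    [∀ j, Fintype (Y j)] (P : ShuffleProtocol n m X Y O) (x : Fin n → X)
    {f : (∀ j, Fin n → Y j) → ℝ}
    (hf : ∀ (y : ∀ j, Fin n → Y j) (σ : Fin m → Equiv.Perm (Fin n)),
      f (fun j i => y j (σ j i)) = f y) :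
    finExp (P.view x) f =
      finExp (pmfPi fun i => P.randomizer (x i)) fun y => f fun j i => y i j := by
  rw [ShuffleProtocol.view, finExp_bind]
  congr 1
  ext y
  rw [finExp_map]
  simp only [hf (fun j i => y i j), finExp_const]

/-- The mean of the number that message `j` encodes. -/
def digitMean {m : ℕ} (p : Fin m → ℕ) (x : unitInterval) (j : Fin m) : ℝ :=
  digit p x j + Int.fract (leftover p x j) * lastInd j

theorem digitMean_nonneg {m : ℕ} (p : Fin m → ℕ) (x : unitInterval) (j : Fin m) :
    0 ≤ digitMean p x j :=
  add_nonneg (Nat.cast_nonneg _) (mul_nonneg (Int.fract_nonneg _) (Nat.cast_nonneg _))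

theorem digitMean_le {m : ℕ} (p : Fin m → ℕ) (x : unitInterval) (j : Fin m) :
    digitMean p x j ≤ msgRange p j := by
  have h1 : (digit p x j : ℝ) ≤ p j := by exact_mod_cast digit_le p x j
  have h2 := mul_le_mul_of_nonneg_right (Int.fract_lt_one (leftover p x j)).le
    (Nat.cast_nonneg (α := ℝ) (lastInd j))
  rw [digitMean, msgRange]
  push_cast
  linarith

theorem finExp_roundedDigit {m : ℕ} (p : Fin m → ℕ) (x : unitInterval) (j : Fin m) (f : ℕ → ℝ) :
    finExp (roundedDigit p x j) (fun a => f a) =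
      Int.fract (leftover p x j) * f (digit p x j + lastInd j) +
        (1 - Int.fract (leftover p x j)) * f (digit p x j) := by
  rw [roundedDigit, finExp_map, finExp_berUnit]
  simp

theorem sum_fin_val (d : ℕ) : ∑ a : Fin (d + 1), ((a : ℕ) : ℝ) = d * (d + 1) / 2 := by
  rw [Fin.sum_univ_eq_sum_range fun a => (a : ℝ)]
  induction d with
  | zero => simp
  | succ d ih =>
    rw [Finset.sum_range_succ, ih]
    push_cast
    ring

/-- The law of message `j` on input `x`. -/
def messageLaw {m : ℕ} (p : Fin m → ℕ) (γ : unitInterval) (x : unitInterval) (j : Fin m) :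
    PMF (Fin (msgRange p j + 1)) :=
  (roundedDigit p x j).bind (randResponse γ (msgRange p j))

theorem finExp_messageLaw_val {m : ℕ} (p : Fin m → ℕ) (γ : unitInterval) (x : unitInterval)
    (j : Fin m) :
    finExp (messageLaw p γ x j) (fun a => ((a : ℕ) : ℝ)) =
      γ * msgRange p j / 2 + (1 - γ) * digitMean p x j := by
  rw [messageLaw, finExp_bind_randResponse, sum_fin_val,
    finExp_roundedDigit p x j fun a => (a : ℝ), digitMean]
  push_cast
  field_simp
  ring

theorem finExp_sub_mean_sq_le {α : Type} [Fintype α] (μ : PMF α) (f : α → ℝ) (e : ℝ) :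
    finExp μ (fun a => (f a - finExp μ f) ^ 2) ≤ finExp μ (fun a => (f a - e) ^ 2) := by
  set c := finExp μ f with hc
  have h : finExp μ (fun a => (f a - e) ^ 2) =
      finExp μ (fun a => (f a - c) ^ 2) + (c - e) ^ 2 := by
    have h1 : (fun a => (f a - e) ^ 2) =
        fun a => ((f a - c) ^ 2 + ((f a - c) * (2 * (c - e)) + (c - e) ^ 2)) := by
      ext a
      ring
    rw [h1, finExp_add, finExp_add, finExp_mul_const, finExp_sub, finExp_const, finExp_const]
    rw [← hc]
    ring
  rw [h]
  linarith [sq_nonneg (c - e)]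

/-- The variance is at most the second moment about `digitMean`. About that point, noise costs at
most the squared range, and a message without noise has only the variance of the rounding bit, at
most `1 / 4`. -/
theorem finExp_messageLaw_sq_le {m : ℕ} (p : Fin m → ℕ) (γ : unitInterval) (x : unitInterval)
    (j : Fin m) :
    finExp (messageLaw p γ x j)
        (fun a => (((a : ℕ) : ℝ) - (γ * msgRange p j / 2 + (1 - γ) * digitMean p x j)) ^ 2) ≤
      γ * (msgRange p j : ℝ) ^ 2 + lastInd j / 4 := by
  have hγ0 : (0 : ℝ) ≤ γ := γ.2.1
  have hγ1 : (γ : ℝ) ≤ 1 := γ.2.2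
  rw [← finExp_messageLaw_val]
  refine (finExp_sub_mean_sq_le _ _ (digitMean p x j)).trans ?_
  rw [messageLaw, finExp_bind_randResponse,
    finExp_roundedDigit p x j fun a => ((a : ℝ) - digitMean p x j) ^ 2]
  refine add_le_add (mul_le_mul_of_nonneg_left ?_ hγ0) ?_
  · rw [div_le_iff₀ (by positivity)]
    have h : ∀ a : Fin (msgRange p j + 1),
        (((a : ℕ) : ℝ) - digitMean p x j) ^ 2 ≤ (msgRange p j : ℝ) ^ 2 := by
      intro a
      have ha : ((a : ℕ) : ℝ) ≤ msgRange p j := by exact_mod_cast Nat.lt_succ_iff.1 a.2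
      have ha0 : (0 : ℝ) ≤ ((a : ℕ) : ℝ) := Nat.cast_nonneg _
      have h1 := digitMean_le p x j
      have h2 := digitMean_nonneg p x j
      exact sq_le_sq' (by linarith) (by linarith)
    refine (Finset.sum_le_sum fun a _ => h a).trans (le_of_eq ?_)
    rw [Finset.sum_const, Finset.card_univ, Fintype.card_fin, nsmul_eq_mul]
    push_cast
    ring
  · have hl : (lastInd j : ℝ) ^ 2 = lastInd j := by
      unfold lastInd
      split_ifs <;> norm_num
    have hl0 : (0 : ℝ) ≤ lastInd j := Nat.cast_nonneg _
    set φ := Int.fract (leftover p x j)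
    have h1 : φ * (((digit p x j + lastInd j : ℕ) : ℝ) - digitMean p x j) ^ 2 +
        (1 - φ) * ((digit p x j : ℝ) - digitMean p x j) ^ 2 = φ * (1 - φ) * lastInd j := by
      rw [← hl, digitMean]
      push_cast
      ring
    rw [h1]
    have h2 : φ * (1 - φ) ≤ 1 / 4 := by nlinarith [sq_nonneg (φ - 1 / 2)]
    have h3 : 0 ≤ φ * (1 - φ) :=
      mul_nonneg (Int.fract_nonneg _) (sub_nonneg.2 (Int.fract_lt_one _).le)
    calc (1 - (γ : ℝ)) * (φ * (1 - φ) * lastInd j) ≤ 1 * (1 / 4 * lastInd j) :=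
          mul_le_mul (by linarith) (mul_le_mul_of_nonneg_right h2 hl0)
            (mul_nonneg h3 hl0) zero_le_one
      _ = _ := by ring

/-- The precisions, extended by `1` to all natural indices. -/
def precExt {m : ℕ} (p : Fin m → ℕ) (l : ℕ) : ℕ := if h : l < m then p ⟨l, h⟩ else 1

/-- The product of the first `k` precisions. -/
def precPartial {m : ℕ} (p : Fin m → ℕ) (k : ℕ) : ℕ := ∏ l ∈ Finset.range k, precExt p l

theorem precPartial_zero {m : ℕ} (p : Fin m → ℕ) : precPartial p 0 = 1 := by simp [precPartial]

theorem precPartial_succ {m : ℕ} (p : Fin m → ℕ) (j : Fin m) :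
    precPartial p (j + 1) = precPartial p j * p j := by
  simp [precPartial, Finset.prod_range_succ, precExt]

theorem prod_Iio_eq_precPartial {m : ℕ} (p : Fin m → ℕ) (j : Fin m) :
    ∏ l ∈ Finset.Iio j, p l = precPartial p j := by
  refine Finset.prod_bij (fun l _ => (l : ℕ)) (fun l hl => ?_) (fun _ _ _ _ h => Fin.ext h)
    (fun l hl => ?_) (fun l _ => by simp [precExt])
  · exact Finset.mem_range.2 (Fin.lt_def.1 (Finset.mem_Iio.1 hl))
  · have hl' := Finset.mem_range.1 hl
    exact ⟨⟨l, hl'.trans j.2⟩, Finset.mem_Iio.2 hl', rfl⟩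

theorem precProd_eq_precPartial {m : ℕ} (p : Fin m → ℕ) (j : Fin m) :
    precProd p j = precPartial p (j + 1) := by
  rw [precProd, ← Finset.Iio_insert, Finset.prod_insert (by simp), prod_Iio_eq_precPartial,
    precPartial_succ, mul_comm]

theorem prevProd_eq {m : ℕ} (p : Fin m → ℕ) (j : Fin m) :
    prevProd p j = if (j : ℕ) = 0 then 0 else precPartial p j := by
  rw [prevProd, prod_Iio_eq_precPartial]

theorem precPartial_pos {m : ℕ} {p : Fin m → ℕ} (hp : ∀ j, 1 ≤ p j) (k : ℕ) :
    0 < precPartial p k := by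
  refine Finset.prod_pos fun l _ => ?_
  unfold precExt
  split_ifs with h
  · exact hp _
  · exact one_pos

theorem leftover_nonneg {m : ℕ} (p : Fin m → ℕ) (x : unitInterval) (j : Fin m) :
    0 ≤ leftover p x j := by
  have hx := x.2.1
  rw [leftover, precProd_eq_precPartial, precPartial_succ, prevProd_eq]
  push_cast
  rw [mul_comm (precPartial p j : ℝ), mul_assoc, ← mul_sub]
  refine mul_nonneg (Nat.cast_nonneg _) ?_
  split_ifs with h
  · simp only [zero_mul, Int.floor_zero, Int.cast_zero, sub_zero]
    exact mul_nonneg (Nat.cast_nonneg _) hx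
  · exact sub_nonneg.2 (Int.floor_le _)

/-- The digits of `x`, weighted by their place values, add up to `x`. -/
theorem sum_digitMean_div {m : ℕ} (hm : 1 ≤ m) {p : Fin m → ℕ} (hp : ∀ j, 1 ≤ p j)
    (x : unitInterval) : ∑ j, digitMean p x j / precProd p j = x := by
  -- Truncations of `x` after `k` digits. `T 0 = 0` reflects the convention `q_0 = 0` and differs
  -- from `⌊x⌋` at `x = 1`; `T m = x` because the rounding bit restores the fractional part in the
  -- mean.
  let T : ℕ → ℝ := fun k => if k = 0 then 0 else if k = m then x else
    (⌊(precPartial p k : ℝ) * (x : ℝ)⌋ : ℝ) / precPartial p k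
  have hT : ∀ j : Fin m, digitMean p x j / precProd p j = T (j + 1) - T j := by
    intro j
    have hq : (0 : ℝ) < precPartial p j := by exact_mod_cast precPartial_pos hp _
    have hpj : (0 : ℝ) < p j := by exact_mod_cast hp j
    have hdig : (digit p x j : ℝ) = (⌊leftover p x j⌋ : ℝ) := by
      rw [digit, natCast_floor_eq_intCast_floor (leftover_nonneg p x j)]
    have hTj : T j = (⌊(prevProd p j : ℝ) * (x : ℝ)⌋ : ℝ) / precPartial p j := by
      simp only [T, prevProd_eq]
      by_cases hj : (j : ℕ) = 0
      · simp [hj]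
      · simp [hj, j.2.ne]
    rw [hTj, digitMean, hdig, precProd_eq_precPartial]
    have hq1 : (precPartial p (j + 1) : ℝ) = precPartial p j * p j := by
      rw [precPartial_succ]
      push_cast
      ring
    by_cases hj : (j : ℕ) + 1 = m
    · have hl : lastInd j = 1 := by simp [lastInd, hj]
      have hT1 : T (j + 1) = x := by simp [T, hj]; omega
      rw [hl, Nat.cast_one, mul_one, Int.floor_add_fract, hT1, leftover, precProd_eq_precPartial,
        hq1]
      field_simp
    · have hl : lastInd j = 0 := by simp [lastInd, hj]
      have hT1 : T (j + 1) = (⌊(precPartial p (j + 1) : ℝ) * (x : ℝ)⌋ : ℝ) /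
        precPartial p (j + 1) := by simp [T, hj]
      have hfl : ⌊leftover p x j⌋ = ⌊(precPartial p (j + 1) : ℝ) * (x : ℝ)⌋ -
          p j * ⌊(prevProd p j : ℝ) * (x : ℝ)⌋ := by
        rw [leftover, precProd_eq_precPartial, ← Int.floor_sub_intCast]
        push_cast
        rfl
      rw [hl, hT1, hfl, hq1]
      push_cast
      field_simp
      ring
  rw [Finset.sum_congr rfl fun j _ => hT j,
    Fin.sum_univ_eq_sum_range (fun k => T (k + 1) - T k), Finset.sum_range_sub]
  have : m ≠ 0 := by omega
  simp [T, this]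

/-- The debiased contribution of message `a` to the estimate. -/
def messageValue {m : ℕ} (p : Fin m → ℕ) (γ : Fin m → unitInterval) (j : Fin m)
    (a : Fin (msgRange p j + 1)) : ℝ :=
  (((a : ℕ) : ℝ) - γ j * msgRange p j / 2) / (1 - γ j) / precProd p j

theorem recProtocol_analyzer_eq {n m : ℕ} (p : Fin m → ℕ) (γ : Fin m → unitInterval)
    (y : ∀ j, Fin n → Fin (msgRange p j + 1)) :
    (recProtocol n p γ).analyzer y = ∑ i, ∑ j, messageValue p γ j (y j i) := by
  rw [Finset.sum_comm]
  change ∑ j, debiasedSum (γ j : ℝ) (msgRange p j) (y j) / precProd p j = _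
  refine Finset.sum_congr rfl fun j _ => ?_
  simp only [messageValue]
  rw [← Finset.sum_div, ← Finset.sum_div, Finset.sum_sub_distrib, debiasedSum]
  simp only [Finset.sum_const, Finset.card_univ, Fintype.card_fin, nsmul_eq_mul]
  congr 3
  ring

/-- The mean squared error of the recursive protocol, in terms of its parameters. -/
theorem recProtocol_MSE_le {n m : ℕ} (hm : 1 ≤ m) {p : Fin m → ℕ} (hp : ∀ j, 1 ≤ p j)
    {γ : Fin m → unitInterval} {κ : ℝ} (hκ : κ < 1) (hγ : ∀ j, (γ j : ℝ) ≤ κ) :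
    (recProtocol n p γ).MSE ≤ ENNReal.ofReal (n / (1 - κ) ^ 2 *
      ∑ j, (γ j * (msgRange p j : ℝ) ^ 2 + lastInd j / 4) / (precProd p j : ℝ) ^ 2) := by
  refine ShuffleProtocol.MSE_le _ fun x => ?_
  -- The analyzer uses only sums over the users, so the shuffling can be dropped.
  rw [ShuffleProtocol.finExp_view]
  swap
  · intro y σ
    simp only [recProtocol, debiasedSum]
    congr 3
    ext j
    rw [Equiv.sum_comp (σ j) fun i => ((y j i : ℕ) : ℝ)]
  simp only [recProtocol_analyzer_eq, ← Finset.sum_sub_distrib]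
  have hγ1 : ∀ j, 0 < 1 - (γ j : ℝ) := fun j => by linarith [hγ j]
  have hq : ∀ j, (0 : ℝ) < precProd p j := fun j => by
    rw [precProd_eq_precPartial]
    exact_mod_cast precPartial_pos hp _
  have hmean : ∀ x j, finExp (messageLaw p (γ j) x j)
      (fun a => messageValue p γ j a - digitMean p x j / precProd p j) = 0 := by
    intro x j
    have h1 : (fun a => messageValue p γ j a - digitMean p x j / precProd p j) = fun a : Fin (msgRange p j + 1) =>
        (((a : ℕ) : ℝ) - (γ j * msgRange p j / 2 + (1 - γ j) * digitMean p x j)) *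
          (1 / ((1 - γ j) * precProd p j)) := by
      ext a
      have := (hγ1 j).ne'
      have := (hq j).ne'
      rw [messageValue]
      field_simp
      ring
    rw [h1, finExp_mul_const, finExp_sub, finExp_messageLaw_val, finExp_const, sub_self, zero_mul]
  have hsplit : ∀ (x : unitInterval) (y : ∀ j, Fin (msgRange p j + 1)),
      ∑ j, messageValue p γ j (y j) - x =
        ∑ j, (messageValue p γ j (y j) - digitMean p x j / precProd p j) := by
    intro x y
    rw [Finset.sum_sub_distrib, sum_digitMean_div hm hp]
  have hrand : ∀ x, (recProtocol n p γ).randomizer x = pmfPi fun j => messageLaw p (γ j) x j :=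
    fun _ => rfl
  simp only [hrand]
  rw [finExp_pmfPi_sum_sq _ fun i (y : ∀ j, Fin (msgRange p j + 1)) =>
    ∑ j, messageValue p γ j (y j) - (x i : ℝ)]
  swap
  · intro i
    simp only [hsplit]
    rw [finExp_pmfPi_sum _ fun j a => messageValue p γ j a - digitMean p (x i) j / precProd p j]
    exact Finset.sum_eq_zero fun j _ => hmean _ _
  have hvar : ∀ i, finExp (pmfPi fun j => messageLaw p (γ j) (x i) j)
      (fun y => (∑ j, messageValue p γ j (y j) - (x i : ℝ)) ^ 2) ≤
      1 / (1 - κ) ^ 2 *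
        ∑ j, (γ j * (msgRange p j : ℝ) ^ 2 + lastInd j / 4) / (precProd p j : ℝ) ^ 2 := by
    intro i
    simp only [hsplit]
    rw [finExp_pmfPi_sum_sq _
      (fun j a => messageValue p γ j a - digitMean p (x i) j / precProd p j) fun j => hmean _ _,
      Finset.mul_sum]
    refine Finset.sum_le_sum fun j _ => ?_
    have h1 : (fun a => (messageValue p γ j a - digitMean p (x i) j / precProd p j) ^ 2) = fun a : Fin (msgRange p j + 1) =>
        (((a : ℕ) : ℝ) - (γ j * msgRange p j / 2 + (1 - γ j) * digitMean p (x i) j)) ^ 2 *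
          (1 / ((1 - γ j) ^ 2 * (precProd p j : ℝ) ^ 2)) := by
      ext a
      have := (hγ1 j).ne'
      have := (hq j).ne'
      rw [messageValue]
      field_simp
      ring
    rw [h1, finExp_mul_const]
    have hv := finExp_messageLaw_sq_le p (γ j) (x i) j
    have hb : 0 ≤ γ j * (msgRange p j : ℝ) ^ 2 + (lastInd j : ℝ) / 4 := by
      have := (γ j).2.1
      positivity
    have hqj := hq j
    have hκ1 : 0 < 1 - κ := by linarith
    calc _ ≤ (γ j * (msgRange p j : ℝ) ^ 2 + lastInd j / 4) *
          (1 / ((1 - κ) ^ 2 * (precProd p j : ℝ) ^ 2)) := by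
          refine mul_le_mul hv ?_ (by have := hγ1 j; positivity) hb
          refine one_div_le_one_div_of_le (by positivity) ?_
          refine mul_le_mul_of_nonneg_right ?_ (by positivity)
          exact pow_le_pow_left₀ hκ1.le (by linarith [hγ j]) 2
      _ = _ := by
        field_simp
  refine (Finset.sum_le_sum fun i _ => hvar i).trans (le_of_eq ?_)
  rw [Finset.sum_const, Finset.card_univ, Fintype.card_fin, nsmul_eq_mul]
  ring

/-! ### Bounds for the precisions -/

theorem sum_lastInd {m : ℕ} (hm : 1 ≤ m) : ∑ j : Fin m, (lastInd j : ℝ) = 1 := by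
  rw [Finset.sum_eq_single (⟨m - 1, by omega⟩ : Fin m)]
  · have : m - 1 + 1 = m := by omega
    simp [lastInd, this]
  · intro j _ hj
    have : (j : ℕ) + 1 ≠ m := fun h => hj (Fin.ext (by simp; omega))
    simp [lastInd, this]
  · simp

theorem msgRange_le {m : ℕ} {p : Fin m → ℕ} {j : Fin m} (hp : 1 ≤ p j) :
    msgRange p j ≤ 2 * p j := by
  unfold msgRange lastInd
  split_ifs <;> omega

/-- The mean squared error when each precision is at most `K` times the squared product of the
previous ones. -/
theorem recProtocol_MSE_le_of_prec {n m : ℕ} (hn : 2 ≤ n) (hm : 1 ≤ m) {ε δ : ℝ}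
    (hδ : 0 < δ) (hδ1 : δ ≤ 1) {p : Fin m → ℕ} (hp : ∀ j, 1 ≤ p j) {γ : Fin m → unitInterval}
    (hγ : ∀ j, (γ j : ℝ) = recGamma n ε δ p j) {κ : ℝ} (hκ : κ < 1) (hγκ : ∀ j, (γ j : ℝ) ≤ κ)
    {K : ℝ} (hK : ∀ j : Fin m, (p j : ℝ) ≤ K * (precPartial p j : ℝ) ^ 2)
    (hKn : (n : ℝ) ≤ K * (precPartial p m : ℝ) ^ 2) :
    (recProtocol n p γ).MSE ≤ ENNReal.ofReal
      (224 * K / (1 - κ) ^ 2 * Real.log (2 * m / δ) * (1 + (m : ℝ) ^ 3 / ε ^ 2)) := by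
  refine (recProtocol_MSE_le hm hp hκ hγκ).trans (ENNReal.ofReal_le_ofReal ?_)
  have hm1 : (1 : ℝ) ≤ m := by exact_mod_cast hm
  have hn2 : (2 : ℝ) ≤ n := by exact_mod_cast hn
  have hL : 1 / 2 ≤ Real.log (2 * m / δ) := by
    have h1 : Real.log 2 ≤ Real.log (2 * m / δ) := by
      refine Real.log_le_log (by norm_num) ?_
      rw [le_div_iff₀ hδ]
      nlinarith
    linarith [Real.log_two_gt_d9]
  have hLeq : Real.log (2 / (δ / m)) = Real.log (2 * m / δ) := by rw [div_div_eq_mul_div]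
  set L := Real.log (2 * m / δ)
  have hQ : ∀ k, (0 : ℝ) < precPartial p k := fun k => by exact_mod_cast precPartial_pos hp k
  have hK0 : 0 < K := by
    have := hQ m
    by_contra h
    nlinarith [mul_nonneg (neg_nonneg.2 (not_lt.1 h)) (sq_nonneg (precPartial p m : ℝ))]
  have hterm : ∀ j : Fin m, (n : ℝ) * (((γ j : ℝ) * (msgRange p j : ℝ) ^ 2 + (lastInd j : ℝ) / 4) /
      (precProd p j : ℝ) ^ 2) ≤ K * (224 * L * ((m : ℝ) ^ 2 / ε ^ 2) + (lastInd j : ℝ) / 4) := by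
    intro j
    have hq := hQ j
    have hpj : (1 : ℝ) ≤ p j := by exact_mod_cast hp j
    have hq1 : (precProd p j : ℝ) = precPartial p j * p j := by
      rw [precProd_eq_precPartial, precPartial_succ]
      push_cast
      ring
    have hqp : 0 < (precProd p j : ℝ) := by rw [hq1]; positivity
    have hd : (msgRange p j : ℝ) ≤ 2 * p j := by exact_mod_cast msgRange_le (hp j)
    have hd0 : (0 : ℝ) ≤ msgRange p j := Nat.cast_nonneg _
    have h1 : (n : ℝ) * ((γ j : ℝ) * (msgRange p j : ℝ) ^ 2) ≤
        K * (224 * L * ((m : ℝ) ^ 2 / ε ^ 2)) * (precProd p j : ℝ) ^ 2 := by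
      have hd' : (p j : ℝ) + (lastInd j : ℝ) = msgRange p j := by simp [msgRange]
      have h2 : (n : ℝ) * ((γ j : ℝ) * (msgRange p j : ℝ) ^ 2) =
          14 * L * ((m : ℝ) ^ 2 / ε ^ 2) * ((n : ℝ) / (n - 1)) * (msgRange p j : ℝ) ^ 3 := by
        rw [hγ, recGamma, hLeq, hd', div_pow]
        have : (n : ℝ) - 1 ≠ 0 := by linarith
        -- For `ε = 0` both sides vanish, as division by zero gives zero.
        by_cases hε : ε = 0
        · simp [hε]
        · field_simp
      have h3 : (n : ℝ) / (n - 1) ≤ 2 := by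
        rw [div_le_iff₀ (by linarith)]
        linarith
      have h4 : (msgRange p j : ℝ) ^ 3 ≤ (2 * p j) ^ 3 := pow_le_pow_left₀ hd0 hd 3
      have h5 : (p j : ℝ) ^ 3 ≤ K * (precProd p j : ℝ) ^ 2 := by
        rw [hq1]
        calc (p j : ℝ) ^ 3 = p j * (p j : ℝ) ^ 2 := by ring
          _ ≤ K * (precPartial p j : ℝ) ^ 2 * (p j : ℝ) ^ 2 :=
            mul_le_mul_of_nonneg_right (hK j) (by positivity)
          _ = _ := by ring
      rw [h2]
      have h0 : 0 ≤ 14 * L * ((m : ℝ) ^ 2 / ε ^ 2) := by positivity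
      -- `224 = 14 * 2 * 2 ^ 3`, from `n / (n - 1) ≤ 2` and `msgRange p j ≤ 2 * p j`.
      calc _ ≤ 14 * L * ((m : ℝ) ^ 2 / ε ^ 2) * 2 * (2 * p j) ^ 3 :=
            mul_le_mul (mul_le_mul_of_nonneg_left h3 h0) h4 (by positivity) (by positivity)
        _ = 224 * L * ((m : ℝ) ^ 2 / ε ^ 2) * (p j : ℝ) ^ 3 := by ring
        _ ≤ 224 * L * ((m : ℝ) ^ 2 / ε ^ 2) * (K * (precProd p j : ℝ) ^ 2) :=
            mul_le_mul_of_nonneg_left h5 (by positivity)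
        _ = _ := by ring
    have h2 : (n : ℝ) * ((lastInd j : ℝ) / 4) ≤ K * ((lastInd j : ℝ) / 4) * (precProd p j : ℝ) ^ 2 := by
      unfold lastInd
      split_ifs with h
      · rw [precProd_eq_precPartial, h]
        push_cast
        linarith
      · simp
    rw [← mul_div_assoc, div_le_iff₀ (by positivity)]
    linarith
  have hsum : (n : ℝ) * ∑ j, ((γ j : ℝ) * (msgRange p j : ℝ) ^ 2 + (lastInd j : ℝ) / 4) /
      (precProd p j : ℝ) ^ 2 ≤ 224 * K * L * (1 + (m : ℝ) ^ 3 / ε ^ 2) := by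
    rw [Finset.mul_sum]
    refine (Finset.sum_le_sum fun j _ => hterm j).trans ?_
    rw [← Finset.mul_sum, Finset.sum_add_distrib, ← Finset.sum_div, sum_lastInd hm,
      Finset.sum_const, Finset.card_univ, Fintype.card_fin, nsmul_eq_mul]
    have h1 : (m : ℝ) * (224 * L * ((m : ℝ) ^ 2 / ε ^ 2)) = 224 * L * ((m : ℝ) ^ 3 / ε ^ 2) := by ring
    rw [h1]
    -- The rounding term has no factor `L`; `L ≥ 1 / 2` lets the summand `1` absorb it.
    have h2 : 1 / 4 ≤ 224 * L := by linarith
    nlinarith [mul_le_mul_of_nonneg_left h2 hK0.le]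
  have hκ1 : 0 < (1 - κ) ^ 2 := by
    have : 0 < 1 - κ := by linarith
    positivity
  calc _ = ((n : ℝ) * ∑ j, ((γ j : ℝ) * (msgRange p j : ℝ) ^ 2 + (lastInd j : ℝ) / 4) /
      (precProd p j : ℝ) ^ 2) / (1 - κ) ^ 2 := by ring
    _ ≤ (224 * K * L * (1 + (m : ℝ) ^ 3 / ε ^ 2)) / (1 - κ) ^ 2 :=
      div_le_div_of_nonneg_right hsum hκ1.le
    _ = _ := by ring

/-- The ideal real precisions, which satisfy `a (k + 1) = a k ^ 3`. -/
def idealPrec (n m k : ℕ) : ℝ := (n : ℝ) ^ ((3 : ℝ) ^ ((k : ℤ) - (m : ℤ)))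

theorem idealPrec_succ (n m k : ℕ) : idealPrec n m (k + 1) = idealPrec n m k ^ 3 := by
  rw [idealPrec, idealPrec, ← Real.rpow_natCast, ← Real.rpow_mul (Nat.cast_nonneg n)]
  congr 1
  push_cast
  rw [show (k : ℤ) + 1 - m = (k - m) + 1 by ring, zpow_add_one₀ (by norm_num)]

theorem idealPrec_self (n m : ℕ) : idealPrec n m m = n := by simp [idealPrec]

theorem idealPrec_zero (n m : ℕ) : idealPrec n m 0 = (n : ℝ) ^ ((3 : ℝ) ^ (-(m : ℤ))) := by
  simp [idealPrec]

theorem one_lt_idealPrec {n : ℕ} (hn : 2 ≤ n) (m k : ℕ) : 1 < idealPrec n m k :=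
  Real.one_lt_rpow (by exact_mod_cast hn) (by positivity)

theorem IsRoundedPrec.one_le {n m : ℕ} (hn : 2 ≤ n) {p : Fin m → ℕ} (h : IsRoundedPrec n p)
    (j : Fin m) : 1 ≤ p j := by
  have h1 := (abs_lt.1 (h j)).1
  have h2 : 1 < (n : ℝ) ^ ((3 : ℝ) ^ (((j : ℕ) : ℤ) - (m : ℤ))) := one_lt_idealPrec hn m j
  have h3 : (0 : ℝ) < p j := by linarith
  exact_mod_cast h3

/-- The rounding error of one precision is paid for by the growth of the potential
`(2 - 1 / a) ^ 4`. -/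
theorem mul_potential_le {a p : ℝ} (ha : 1 < a) (hp : 1 ≤ p) (hap : a - 1 ≤ p) :
    a * (2 - 1 / a) ^ 4 ≤ p * (2 - 1 / a ^ 3) ^ 4 := by
  obtain ⟨b, hb⟩ : ∃ b, b = 1 / a := ⟨_, rfl⟩
  have hb0 : 0 < b := by rw [hb]; positivity
  have hb1 : b < 1 := by rw [hb, div_lt_one (by linarith)]; exact ha
  have hab : a * b = 1 := by rw [hb]; field_simp
  have hb3 : 1 / a ^ 3 = b ^ 3 := by rw [hb]; field_simp
  rw [hb3, ← hb]
  have h2b : 0 < 2 - b := by linarith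
  -- `1 + u` is the growth of `2 - 1 / a` when `a` is replaced by `a ^ 3`.
  set u := b * (1 - b ^ 2) / (2 - b) with hu
  have hu0 : 0 ≤ u := div_nonneg (mul_nonneg hb0.le (by nlinarith)) h2b.le
  have hfac : 2 - b ^ 3 = (2 - b) * (1 + u) := by
    rw [hu]
    field_simp
    ring
  have hbern : 1 + 4 * u ≤ (1 + u) ^ 4 := by
    nlinarith [pow_nonneg hu0 2, pow_nonneg hu0 3, pow_nonneg hu0 4]
  have hkey : a ≤ p * (1 + 4 * u) := by
    have hmul : (2 - b) * u = b * (1 - b ^ 2) := by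
      rw [hu]
      field_simp
    -- For `a ≥ 2` the bound `p ≥ a - 1 = a * (1 - b)` is used, for `a ≤ 2` the bound `p ≥ 1 = a *
    -- b`. At `b = 1 / 2` one has `u = 1 / 4` and both required inequalities are equalities, which
    -- is where the exponent `4` comes from.
    rcases le_total b (1 / 2) with h | h
    · have h1 : 1 ≤ (1 - b) * (1 + 4 * u) := by
        have h2 : 2 - b ≤ (1 - b) * ((2 - b) + 4 * ((2 - b) * u)) := by
          rw [hmul]
          nlinarith [mul_nonneg hb0.le (mul_nonneg (sub_nonneg.2 h)
            (by nlinarith : 0 ≤ 2 + b - 2 * b ^ 2))]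
        by_contra h3
        nlinarith [mul_lt_mul_of_pos_left (not_le.1 h3) h2b]
      have h2 : a * (1 - b) ≤ p := by linarith
      calc a ≤ a * ((1 - b) * (1 + 4 * u)) := by nlinarith
        _ = a * (1 - b) * (1 + 4 * u) := by ring
        _ ≤ p * (1 + 4 * u) := mul_le_mul_of_nonneg_right h2 (by linarith)
    · have h1 : 1 ≤ b * (1 + 4 * u) := by
        have h2 : 2 - b ≤ b * ((2 - b) + 4 * ((2 - b) * u)) := by
          rw [hmul]
          have h3 : 2 - b ≤ 4 * b ^ 2 * (1 + b) := by nlinarith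
          nlinarith [mul_le_mul_of_nonneg_left h3 (sub_nonneg.2 hb1.le)]
        by_contra h3
        nlinarith [mul_lt_mul_of_pos_left (not_le.1 h3) h2b]
      calc a ≤ a * (b * (1 + 4 * u)) := by nlinarith
        _ = 1 * (1 + 4 * u) := by rw [← mul_assoc, hab]
        _ ≤ p * (1 + 4 * u) := mul_le_mul_of_nonneg_right hp (by linarith)
  rw [hfac, mul_pow]
  calc a * (2 - b) ^ 4 ≤ p * (1 + 4 * u) * (2 - b) ^ 4 :=
        mul_le_mul_of_nonneg_right hkey (by positivity)
    _ ≤ p * (1 + u) ^ 4 * (2 - b) ^ 4 := mul_le_mul_of_nonneg_right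
        (mul_le_mul_of_nonneg_left hbern (by linarith)) (by positivity)
    _ = _ := by ring

/-- Without rounding, `a k = a 0 * (a 0 * ⋯ * a (k - 1)) ^ 2`. The potential stays between `1` and
`2 ^ 4`, so the loss over all roundings is bounded however many there are. -/
theorem idealPrec_le_potential {n m : ℕ} (hn : 2 ≤ n) {p : Fin m → ℕ} (h : IsRoundedPrec n p) :
    ∀ k, k ≤ m → idealPrec n m k ≤ idealPrec n m 0 *
      ((2 - 1 / idealPrec n m k) ^ 4 * precPartial p k) ^ 2 := by
  intro k
  induction k with
  | zero =>
    intro _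
    have h1 := one_lt_idealPrec hn m 0
    have h2 : 1 / idealPrec n m 0 ≤ 1 := by
      rw [div_le_one (by linarith)]
      exact h1.le
    rw [precPartial_zero]
    have h3 : (1 : ℝ) ≤ ((2 - 1 / idealPrec n m 0) ^ 4 * (1 : ℕ)) ^ 2 := by
      push_cast
      rw [mul_one]
      exact one_le_pow₀ (one_le_pow₀ (by linarith))
    nlinarith
  | succ k ih =>
    intro hk
    have ih := ih (by omega)
    let j : Fin m := ⟨k, by omega⟩
    have hq : (precPartial p (k + 1) : ℝ) = precPartial p k * p j := by
      exact_mod_cast precPartial_succ p j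
    have ha := one_lt_idealPrec hn m k
    have hp : (1 : ℝ) ≤ p j := by exact_mod_cast h.one_le hn j
    have hap : idealPrec n m k - 1 ≤ p j := by
      have := (abs_lt.1 (h j)).1
      change -1 < (p j : ℝ) - idealPrec n m k at this
      linarith
    have hpot := mul_potential_le ha hp hap
    have hinv : 1 / idealPrec n m k ≤ 1 := by
      rw [div_le_one (by linarith)]
      exact ha.le
    have ha0 := one_lt_idealPrec hn m 0
    rw [hq, idealPrec_succ]
    set a := idealPrec n m k
    set A := idealPrec n m 0
    set Q := (precPartial p k : ℝ)
    have hQ0 : 0 ≤ Q := Nat.cast_nonneg _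
    calc a ^ 3 = a * a ^ 2 := by ring
      _ ≤ A * ((2 - 1 / a) ^ 4 * Q) ^ 2 * a ^ 2 := mul_le_mul_of_nonneg_right ih (by positivity)
      _ = A * (Q * (a * (2 - 1 / a) ^ 4)) ^ 2 := by ring
      _ ≤ A * (Q * (p j * (2 - 1 / a ^ 3) ^ 4)) ^ 2 := by
        refine mul_le_mul_of_nonneg_left ?_ (by linarith)
        refine pow_le_pow_left₀ (by positivity) ?_ 2
        exact mul_le_mul_of_nonneg_left hpot hQ0
      _ = _ := by ring

theorem idealPrec_le_mul_sq {n m : ℕ} (hn : 2 ≤ n) {p : Fin m → ℕ} (h : IsRoundedPrec n p)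
    {k : ℕ} (hk : k ≤ m) :
    idealPrec n m k ≤ 256 * idealPrec n m 0 * (precPartial p k : ℝ) ^ 2 := by
  refine (idealPrec_le_potential hn h k hk).trans ?_
  have ha := one_lt_idealPrec hn m k
  have ha0 := one_lt_idealPrec hn m 0
  have h1 : 1 / idealPrec n m k ≤ 1 := by
    rw [div_le_one (by linarith)]
    exact ha.le
  have h2 : 0 < 1 / idealPrec n m k := by positivity
  have h3 : (2 - 1 / idealPrec n m k) ^ 4 ≤ 2 ^ 4 :=
    pow_le_pow_left₀ (by linarith) (by linarith) 4
  calc _ ≤ idealPrec n m 0 * (2 ^ 4 * precPartial p k) ^ 2 := by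
        refine mul_le_mul_of_nonneg_left ?_ (by linarith)
        exact pow_le_pow_left₀ (by positivity)
          (mul_le_mul_of_nonneg_right h3 (Nat.cast_nonneg _)) 2
    _ = _ := by ring

theorem IsRoundedPrec.le_two_mul {n m : ℕ} (hn : 2 ≤ n) {p : Fin m → ℕ} (h : IsRoundedPrec n p)
    (j : Fin m) : (p j : ℝ) ≤ 2 * idealPrec n m j := by
  have h1 := (abs_lt.1 (h j)).2
  change (p j : ℝ) - idealPrec n m j < 1 at h1
  linarith [one_lt_idealPrec hn m j]

theorem IsRoundedPrec.le_mul_sq {n m : ℕ} (hn : 2 ≤ n) {p : Fin m → ℕ} (h : IsRoundedPrec n p)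
    (j : Fin m) : (p j : ℝ) ≤ 512 * idealPrec n m 0 * (precPartial p j : ℝ) ^ 2 := by
  linarith [h.le_two_mul hn j, idealPrec_le_mul_sq hn h j.2.le]

theorem IsRoundedPrec.natCast_le_mul_sq {n m : ℕ} (hn : 2 ≤ n) {p : Fin m → ℕ}
    (h : IsRoundedPrec n p) :
    (n : ℝ) ≤ 512 * idealPrec n m 0 * (precPartial p m : ℝ) ^ 2 := by
  have h1 := idealPrec_le_mul_sq hn h le_rfl
  rw [idealPrec_self] at h1
  have h2 : (0 : ℝ) ≤ n := Nat.cast_nonneg _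
  linarith

/-- Here no rounding occurs and the balance is exact, as `3 ^ (k + 1) = 3 + 2 * (3 + ⋯ + 3 ^ k)`. -/
theorem two_pow_eq_mul_sq {m : ℕ} {p : Fin m → ℕ} (hp : ∀ j : Fin m, p j = 2 ^ 3 ^ ((j : ℕ) + 1)) :
    ∀ k, k ≤ m → 2 ^ 3 ^ (k + 1) = 8 * precPartial p k ^ 2 := by
  intro k
  induction k with
  | zero => simp [precPartial_zero]
  | succ k ih =>
    intro hk
    have hq : precPartial p (k + 1) = precPartial p k * p ⟨k, by omega⟩ :=
      precPartial_succ p ⟨k, by omega⟩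
    rw [hq, hp, mul_pow, ← mul_assoc, ← ih (by omega), ← pow_succ', ← pow_mul]
    ring

/-! ### The number of messages -/

theorem three_pow_le_logb {n m : ℕ} (hn : 2 ≤ n) (hm : (m : ℝ) ≤ Real.logb 3 (Real.logb 2 n)) :
    (3 : ℝ) ^ m ≤ Real.logb 2 n := by
  have hX : 0 < Real.logb 2 n := Real.logb_pos (by norm_num) (by exact_mod_cast hn)
  rwa [Real.le_logb_iff_rpow_le (by norm_num) hX, Real.rpow_natCast] at hm

theorem natCast_le_two_pow {n m : ℕ} (hn : 2 ≤ n) (hm : m = ⌊Real.logb 3 (Real.logb 2 n)⌋₊) :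
    (n : ℝ) ≤ (2 : ℝ) ^ 3 ^ (m + 1) := by
  have hX : 0 < Real.logb 2 n := Real.logb_pos (by norm_num) (by exact_mod_cast hn)
  have h := (Nat.lt_floor_add_one (Real.logb 3 (Real.logb 2 n))).le
  rw [← hm, Real.logb_le_iff_le_rpow (by norm_num) hX,
    Real.logb_le_iff_le_rpow (by norm_num) (by positivity)] at h
  refine h.trans (le_of_eq ?_)
  rw [← Real.rpow_natCast 2]
  congr 1
  push_cast
  rw [← Real.rpow_natCast]
  push_cast
  rfl

/-- Rounding `log₃ log₂ n` down loses less than one in `m`, hence at most a cube: `2` becomes `2 ^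
3`. -/
theorem idealPrec_zero_le_eight {n m : ℕ} (hn : 2 ≤ n)
    (hm : m = ⌊Real.logb 3 (Real.logb 2 n)⌋₊) : idealPrec n m 0 ≤ 8 := by
  rw [idealPrec_zero]
  calc (n : ℝ) ^ ((3 : ℝ) ^ (-(m : ℤ)))
      ≤ ((2 : ℝ) ^ 3 ^ (m + 1)) ^ ((3 : ℝ) ^ (-(m : ℤ))) :=
        Real.rpow_le_rpow (Nat.cast_nonneg _) (natCast_le_two_pow hn hm) (by positivity)
    _ = 8 := by
      rw [← Real.rpow_natCast 2, ← Real.rpow_mul (by norm_num)]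
      have : ((3 ^ (m + 1) : ℕ) : ℝ) * (3 : ℝ) ^ (-(m : ℤ)) = (3 : ℕ) := by
        push_cast
        rw [zpow_neg, zpow_natCast, pow_succ]
        field_simp
      rw [this, Real.rpow_natCast]
      norm_num

theorem half_le_log_log {n m : ℕ} (hn : 2 ≤ n) (hm1 : 1 ≤ m)
    (hm : (m : ℝ) ≤ Real.logb 3 (Real.logb 2 n)) : (m : ℝ) / 2 ≤ Real.log (Real.log n) := by
  have h3 := three_pow_le_logb hn hm
  have hl2 := Real.log_two_gt_d9
  have hlog : (3 : ℝ) ^ m * Real.log 2 ≤ Real.log n := by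
    rwa [Real.logb, le_div_iff₀ (by linarith)] at h3
  have hpos : 0 < Real.log n := Real.log_pos (by exact_mod_cast hn)
  rw [Real.le_log_iff_exp_le hpos]
  refine le_trans ?_ hlog
  have he : Real.exp (1 / 2) ≤ 2 := by
    have h := Real.exp_bound' (x := 1 / 2) (by norm_num) (by norm_num) (n := 1) (by norm_num)
    norm_num [Finset.sum_range_succ, Nat.factorial] at h
    linarith
  calc Real.exp ((m : ℝ) / 2) = Real.exp (1 / 2) ^ m := by
        rw [← Real.exp_nat_mul]
        ring_nf
    _ ≤ 2 ^ m := pow_le_pow_left₀ (Real.exp_pos _).le he m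
    _ = 2 ^ m * 1 := (mul_one _).symm
    _ ≤ 2 ^ m * ((3 / 2) ^ m * Real.log 2) := by
        refine mul_le_mul_of_nonneg_left ?_ (by positivity)
        -- `m ≥ 1` is needed, since `log 2 < 1` but `3 / 2 * log 2 > 1`.
        have h : (3 / 2 : ℝ) ^ 1 ≤ (3 / 2) ^ m := pow_le_pow_right₀ (by norm_num) hm1
        nlinarith
    _ = 3 ^ m * Real.log 2 := by
        rw [← mul_assoc, ← mul_pow]
        norm_num

theorem one_add_cube_div_le {m : ℕ} (hm : 1 ≤ m) {ε l : ℝ} (h0 : 0 < ε) (h1 : ε ≤ m)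
    (hl : (m : ℝ) / 2 ≤ l) : 1 + (m : ℝ) ^ 3 / ε ^ 2 ≤ 16 * (l ^ 3 / ε ^ 2) := by
  have hm1 : (1 : ℝ) ≤ m := by exact_mod_cast hm
  have h2 : ε ^ 2 ≤ (m : ℝ) ^ 3 :=
    (pow_le_pow_left₀ h0.le h1 2).trans (pow_le_pow_right₀ hm1 (by norm_num))
  have h3 : ((m : ℝ) / 2) ^ 3 ≤ l ^ 3 := pow_le_pow_left₀ (by positivity) hl 3
  have h4 : 0 < ε ^ 2 := by positivity
  rw [← mul_div_assoc, one_add_div h4.ne']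
  refine div_le_div_of_nonneg_right ?_ h4.le
  nlinarith

/-- `log (2 m / δ)` can be replaced by `log (2 / δ)` if `δ ≤ 1 / m`. -/
theorem le_ofReal_log_of_le {M : ENNReal} {m : ℕ} (hm : 1 ≤ m) {c κ δ B : ℝ} (hc : 0 ≤ c)
    (hB : 0 ≤ B) (hδ : 0 < δ) (hδ1 : δ ≤ 1)
    (hM : M ≤ ENNReal.ofReal (c / (1 - κ) ^ 2 * Real.log (2 * m / δ) * B)) :
    M ≤ ENNReal.ofReal (2 * c / (1 - κ) ^ 2 * Real.log (2 * m / δ) * B) ∧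
      (δ ≤ 1 / m → M ≤ ENNReal.ofReal (2 * c / (1 - κ) ^ 2 * Real.log (2 / δ) * B)) := by
  have hm1 : (1 : ℝ) ≤ m := by exact_mod_cast hm
  have hcκ : 0 ≤ c / (1 - κ) ^ 2 := div_nonneg hc (sq_nonneg _)
  have main : ∀ L, Real.log (2 * m / δ) ≤ 2 * L →
      M ≤ ENNReal.ofReal (2 * c / (1 - κ) ^ 2 * L * B) := by
    intro L hL
    refine hM.trans (ENNReal.ofReal_le_ofReal ?_)
    calc _ ≤ c / (1 - κ) ^ 2 * (2 * L) * B :=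
          mul_le_mul_of_nonneg_right (mul_le_mul_of_nonneg_left hL hcκ) hB
      _ = _ := by ring
  refine ⟨main _ ?_, fun h => main _ ?_⟩
  · have : 0 ≤ Real.log (2 * m / δ) := by
      rw [← div_div_eq_mul_div]
      exact log_two_div_nonneg hm hδ hδ1
    linarith
  · have h2 : 2 * Real.log (2 / δ) = Real.log ((2 / δ) ^ 2) := by
      rw [Real.log_pow]
      norm_num
    rw [h2]
    refine Real.log_le_log (by positivity) ?_
    rw [le_div_iff₀ (by positivity)] at h
    rw [div_pow, div_le_div_iff₀ hδ (by positivity)]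
    nlinarith

theorem le_one_of_two_mul_le_log {ε δ : ℝ} (h0 : 0 < ε)
    (h : 2 * ε ≤ Real.log (1 / δ)) : δ ≤ 1 := by
  by_contra h1
  have : Real.log (1 / δ) ≤ 0 := by
    rw [one_div, Real.log_inv]
    linarith [Real.log_nonneg (not_le.1 h1).le]
  linarith

/-! ### The noise probabilities for large `n` -/

theorem recGamma_nonneg {n m : ℕ} (hn : 2 ≤ n) (hm : 1 ≤ m) {ε δ : ℝ} (hδ : 0 < δ) (hδ1 : δ ≤ 1)
    (p : Fin m → ℕ) (j : Fin m) : 0 ≤ recGamma n ε δ p j := by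
  have hn2 : (2 : ℝ) ≤ n := by exact_mod_cast hn
  have := log_two_div_nonneg hm hδ hδ1
  have hn1 : 0 ≤ (n : ℝ) - 1 := by linarith
  unfold recGamma
  positivity

/-- Up to constants `γ_j` is at most `n ^ (1 / 3) * (log n) ^ 3 / n`: one logarithm comes from `δ`,
two from `m ^ 2`. Bounding `log n` by `9 * n ^ (1 / 9)` turns the three into another `n ^ (1 / 3)`,
so a factor `n ^ (1 / 3)` is left to beat the constants; `489888 = 4 * 14 * 3 * 9 * 18 ^ 2`. -/
theorem recGamma_le_half {n m k : ℕ} (hn : 2 ≤ n) {ε δ : ℝ} (h0 : 0 < ε) (hm1 : 1 ≤ m)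
    (hm : (m : ℝ) ≤ Real.logb 3 (Real.logb 2 n)) (hδ : 1 / (n : ℝ) ^ k ≤ δ)
    {p : Fin m → ℕ} (hp : IsRoundedPrec n p)
    (hlarge : 489888 * (k + 3) / ε ^ 2 ≤ (n : ℝ) ^ (1 / 3 : ℝ)) (j : Fin m) :
    recGamma n ε δ p j ≤ 1 / 2 := by
  have hn2 : (2 : ℝ) ≤ n := by exact_mod_cast hn
  have hn0 : (0 : ℝ) < n := by linarith
  have hm1' : (1 : ℝ) ≤ m := by exact_mod_cast hm1
  have hδ0 : 0 < δ := lt_of_lt_of_le (by positivity) hδ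
  set t := (n : ℝ) ^ (1 / 3 : ℝ) with ht
  set u := (n : ℝ) ^ (1 / 9 : ℝ) with hu
  have ht0 : 0 < t := by positivity
  have hu0 : 0 < u := by positivity
  have hut : u ^ 3 = t := by
    rw [hu, ht, ← Real.rpow_natCast, ← Real.rpow_mul hn0.le]
    norm_num
  have htn : t ^ 3 = n := by
    rw [ht, ← Real.rpow_natCast, ← Real.rpow_mul hn0.le]
    norm_num
  have hlog : Real.log n ≤ 9 * u := by
    have := Real.log_le_rpow_div hn0.le (ε := 1 / 9) (by norm_num)
    linarith
  have hlog0 : 0 ≤ Real.log n := Real.log_nonneg (by linarith)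
  have hmlog : (m : ℝ) ≤ 2 * Real.log n := by
    have h1 : (m : ℝ) ≤ 3 ^ m := by exact_mod_cast (Nat.lt_pow_self (by norm_num)).le
    have h2 := h1.trans (three_pow_le_logb hn hm)
    rw [Real.logb, le_div_iff₀ (Real.log_pos (by norm_num))] at h2
    have := Real.log_two_gt_d9
    nlinarith
  have hL : Real.log (2 / (δ / m)) ≤ (k + 3) * Real.log n := by
    have h1 : ((k : ℝ) + 3) * Real.log n = Real.log ((n : ℝ) ^ (k + 3)) := by
      rw [Real.log_pow]
      push_cast
      ring
    rw [h1]
    refine Real.log_le_log (by positivity) ?_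
    rw [div_div_eq_mul_div, div_le_iff₀ hδ0]
    have h2 : (m : ℝ) ≤ 2 * n := by linarith [Real.log_le_self hn0.le]
    have h3 : (1 : ℝ) ≤ (n : ℝ) ^ k * δ := by
      rw [div_le_iff₀ (by positivity)] at hδ
      linarith
    have h4 : (4 : ℝ) * n ≤ (n : ℝ) ^ 3 := by
      nlinarith [mul_nonneg hn0.le (by nlinarith : (0 : ℝ) ≤ (n : ℝ) ^ 2 - 4)]
    calc (2 : ℝ) * m ≤ (n : ℝ) ^ 3 * 1 := by linarith
      _ ≤ (n : ℝ) ^ 3 * ((n : ℝ) ^ k * δ) := mul_le_mul_of_nonneg_left h3 (by positivity)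
      _ = _ := by ring
  have hd : (p j : ℝ) + (lastInd j : ℝ) ≤ 3 * t := by
    have h1 : idealPrec n m j ≤ t := by
      refine Real.rpow_le_rpow_of_exponent_le (by linarith) ?_
      have h2 : (3 : ℝ) ^ (((j : ℕ) : ℤ) - (m : ℤ)) ≤ 3 ^ (-1 : ℤ) :=
        zpow_le_zpow_right₀ (by norm_num) (by have := j.2; omega)
      refine h2.trans (by norm_num)
    have h2 : (lastInd j : ℝ) ≤ 1 := by
      unfold lastInd
      split_ifs <;> norm_num
    linarith [hp.le_two_mul hn j, one_lt_idealPrec hn m j]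
  have hε2 : 0 < ε ^ 2 := by positivity
  rw [div_le_iff₀ hε2] at hlarge
  have hn1 : (0 : ℝ) < (n : ℝ) - 1 := by linarith
  rw [recGamma, div_le_iff₀ (by positivity), div_pow]
  have key : 14 * ((p j : ℝ) + (lastInd j : ℝ)) * Real.log (2 / (δ / m)) * (m : ℝ) ^ 2 ≤
      1 / 2 * (((n : ℝ) - 1) * ε ^ 2) := by
    calc 14 * ((p j : ℝ) + (lastInd j : ℝ)) * Real.log (2 / (δ / m)) * (m : ℝ) ^ 2
        ≤ 14 * (3 * t) * ((k + 3) * (9 * u)) * (2 * (9 * u)) ^ 2 := by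
          have h1 : Real.log (2 / (δ / m)) ≤ (k + 3) * (9 * u) :=
            hL.trans (mul_le_mul_of_nonneg_left hlog (by positivity))
          have h2 : (m : ℝ) ^ 2 ≤ (2 * (9 * u)) ^ 2 :=
            pow_le_pow_left₀ (by positivity) (by linarith) 2
          have h3 : 14 * ((p j : ℝ) + (lastInd j : ℝ)) ≤ 14 * (3 * t) := by linarith
          have h4 : 14 * ((p j : ℝ) + (lastInd j : ℝ)) * Real.log (2 / (δ / m)) ≤
              14 * (3 * t) * ((k + 3) * (9 * u)) :=
            (mul_le_mul_of_nonneg_left h1 (by positivity)).trans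
              (mul_le_mul_of_nonneg_right h3 (by positivity))
          exact mul_le_mul h4 h2 (by positivity) (by positivity)
      _ = 122472 * (k + 3) * t * u ^ 3 := by ring
      _ = 1 / 4 * (t ^ 2 * (489888 * (k + 3))) := by
          rw [hut]
          ring
      _ ≤ 1 / 4 * (t ^ 2 * (t * ε ^ 2)) := by gcongr
      _ = 1 / 2 * (n / 2 * ε ^ 2) := by
          rw [← htn]
          ring
      _ ≤ _ := by
          have : (n : ℝ) / 2 ≤ n - 1 := by linarith
          gcongr
  rw [← mul_div_assoc, ← mul_div_assoc, le_div_iff₀ (by positivity)]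
  exact key

theorem eventually_recGamma_le_half (ε : ℝ) (k : ℕ) (h0 : 0 < ε) : ∀ᶠ n : ℕ in Filter.atTop,
    ∀ (m : ℕ) (δ : ℝ), 1 ≤ m → (m : ℝ) ≤ Real.logb 3 (Real.logb 2 n) →
      1 / (n : ℝ) ^ k ≤ δ → δ < 1 → ∀ p : Fin m → ℕ, IsRoundedPrec n p →
        ∀ j, 0 ≤ recGamma n ε δ p j ∧ recGamma n ε δ p j ≤ 1 / 2 := by
  have hlim : Filter.Tendsto (fun n : ℕ => (n : ℝ) ^ (1 / 3 : ℝ)) Filter.atTop Filter.atTop :=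
    (tendsto_rpow_atTop (by norm_num)).comp tendsto_natCast_atTop_atTop
  filter_upwards [Filter.eventually_ge_atTop 2, hlim.eventually_ge_atTop
    (489888 * (k + 3) / ε ^ 2)] with n hn hlarge m δ hm1 hm hδ hδ1 p hp j
  have hn0 : (0 : ℝ) < n := by exact_mod_cast (by omega : 0 < n)
  have hδ0 : 0 < δ := lt_of_lt_of_le (by positivity) hδ
  exact ⟨recGamma_nonneg hn hm1 hδ0 hδ1.le p j, recGamma_le_half hn h0 hm1 hm hδ hp hlarge j⟩

end

/-! ### The main theorem: matching the constants -/

theorem mainTheorem4 :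
    ∃ C : ℝ, 0 < C ∧
      -- privacy and error for `m` messages
      (∀ (n m : ℕ) (ε δ : ℝ), 2 ≤ n → 1 ≤ m → 0 < ε → ε ≤ m → 0 < δ →
        2 * ε ≤ Real.log (1 / δ) →
        ∀ (p : Fin m → ℕ) (γ : Fin m → unitInterval), IsRoundedPrec n p →
          (∀ j, (γ j : ℝ) = recGamma n ε δ p j) →
          (recProtocol n p γ).IsDP ε δ ∧
          ∀ κ : ℝ, κ < 1 → (∀ j, (γ j : ℝ) ≤ κ) →
            (recProtocol n p γ).MSE ≤ ENNReal.ofReal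
              (C / (1 - κ) ^ 2 * Real.log (2 * m / δ) *
                ((n : ℝ) ^ ((3 : ℝ) ^ (-(m : ℤ))) * (1 + (m : ℝ) ^ 3 / ε ^ 2))) ∧
            (δ ≤ 1 / m →
              (recProtocol n p γ).MSE ≤ ENNReal.ofReal
                (C / (1 - κ) ^ 2 * Real.log (2 / δ) *
                  ((n : ℝ) ^ ((3 : ℝ) ^ (-(m : ℤ))) * (1 + (m : ℝ) ^ 3 / ε ^ 2))))) ∧
      -- `m = ⌊log₃ log₂ n⌋` messages, for either choice of the precisions
      (∀ (n m : ℕ) (ε δ : ℝ), 2 ≤ n → 1 ≤ m → m = ⌊Real.logb 3 (Real.logb 2 n)⌋₊ →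
        0 < ε → ε ≤ m → 0 < δ → 2 * ε ≤ Real.log (1 / δ) →
        ∀ (p : Fin m → ℕ) (γ : Fin m → unitInterval),
          (IsRoundedPrec n p ∨ ∀ j : Fin m, p j = 2 ^ 3 ^ ((j : ℕ) + 1)) →
          (∀ j, (γ j : ℝ) = recGamma n ε δ p j) →
          (recProtocol n p γ).IsDP ε δ ∧
          ∀ κ : ℝ, κ < 1 → (∀ j, (γ j : ℝ) ≤ κ) →
            (recProtocol n p γ).MSE ≤ ENNReal.ofReal
              (C / (1 - κ) ^ 2 * Real.log (2 * m / δ) *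
                (Real.log (Real.log n) ^ 3 / ε ^ 2)) ∧
            (δ ≤ 1 / m →
              (recProtocol n p γ).MSE ≤ ENNReal.ofReal
                (C / (1 - κ) ^ 2 * Real.log (2 / δ) *
                  (Real.log (Real.log n) ^ 3 / ε ^ 2)))) ∧
      -- for all large `n` the probabilities `γ_j` exist and are at most `1 / 2`
      (∀ (ε : ℝ) (k : ℕ), 0 < ε → ∀ᶠ n : ℕ in Filter.atTop,
        ∀ (m : ℕ) (δ : ℝ), 1 ≤ m → (m : ℝ) ≤ Real.logb 3 (Real.logb 2 n) →
          1 / (n : ℝ) ^ k ≤ δ → δ < 1 →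
          ∀ p : Fin m → ℕ, IsRoundedPrec n p →
            ∀ j, 0 ≤ recGamma n ε δ p j ∧ recGamma n ε δ p j ≤ 1 / 2) := by
  -- `224` comes from the variance bound, `512` from rounding, and `128 = 8 * 16` from `idealPrec n
  -- m 0 ≤ 8` and from passing to `log log n`; the `2` pays for the change of logarithm.
  refine ⟨2 * (224 * 512 * 128), by norm_num, ?_, ?_, eventually_recGamma_le_half⟩
  · intro n m ε δ hn hm h0 h1 hδ hεδ p γ hp hγ
    have hδ1 := le_one_of_two_mul_le_log h0 hεδ
    have hp1 := hp.one_le hn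
    refine ⟨recProtocol_isDP hn hm h0 h1 hδ hδ1 p γ hp1 hγ, fun κ hκ hγκ => ?_⟩
    refine le_ofReal_log_of_le hm (by norm_num) (by positivity) hδ hδ1 ?_
    refine (recProtocol_MSE_le_of_prec hn hm hδ hδ1 hp1 hγ hκ hγκ (fun j => hp.le_mul_sq hn j)
      (hp.natCast_le_mul_sq hn)).trans (ENNReal.ofReal_le_ofReal ?_)
    rw [idealPrec_zero]
    have hL : 0 ≤ Real.log (2 * m / δ) := by
      rw [← div_div_eq_mul_div]
      exact log_two_div_nonneg hm hδ hδ1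
    have hZ : 0 ≤ 1 / (1 - κ) ^ 2 * Real.log (2 * m / δ) *
        ((n : ℝ) ^ ((3 : ℝ) ^ (-(m : ℤ))) * (1 + (m : ℝ) ^ 3 / ε ^ 2)) := by positivity
    linear_combination (224 * 512 * 127) * hZ
  · intro n m ε δ hn hm hmn h0 h1 hδ hεδ p γ hp hγ
    have hδ1 := le_one_of_two_mul_le_log h0 hεδ
    have hm_le : (m : ℝ) ≤ Real.logb 3 (Real.logb 2 n) := by
      have h2 : ⌊Real.logb 3 (Real.logb 2 n)⌋₊ ≠ 0 := by omega
      rw [hmn]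
      -- `⌊·⌋₊` is `0` on negative reals, so `m ≥ 1` is what makes the iterated logarithm positive.
      exact Nat.floor_le (le_of_lt (by
        by_contra h3
        exact h2 (Nat.floor_of_nonpos (not_lt.1 h3))))
    have hp1 : ∀ j, 1 ≤ p j := by
      rcases hp with hp | hp
      · exact hp.one_le hn
      · exact fun j => by rw [hp]; exact Nat.one_le_two_pow
    obtain ⟨K, hK0, hK1, hK, hKn⟩ : ∃ K : ℝ, 0 ≤ K ∧ K ≤ 512 * 8 ∧
        (∀ j : Fin m, (p j : ℝ) ≤ K * (precPartial p j : ℝ) ^ 2) ∧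
        (n : ℝ) ≤ K * (precPartial p m : ℝ) ^ 2 := by
      rcases hp with hp | hp
      · exact ⟨512 * idealPrec n m 0, by linarith [one_lt_idealPrec hn m 0],
          by linarith [idealPrec_zero_le_eight hn hmn], fun j => hp.le_mul_sq hn j,
          hp.natCast_le_mul_sq hn⟩
      · refine ⟨8, by norm_num, by norm_num, fun j => ?_, ?_⟩
        · rw [hp]
          exact_mod_cast (two_pow_eq_mul_sq hp j j.2.le).le
        · refine (natCast_le_two_pow hn hmn).trans ?_
          exact_mod_cast (two_pow_eq_mul_sq hp m le_rfl).le
    have hl := half_le_log_log hn hm hm_le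
    have hl0 : 0 ≤ Real.log (Real.log n) := le_trans (by positivity) hl
    refine ⟨recProtocol_isDP hn hm h0 h1 hδ hδ1 p γ hp1 hγ, fun κ hκ hγκ => ?_⟩
    refine le_ofReal_log_of_le hm (by norm_num) (by positivity) hδ hδ1 ?_
    refine (recProtocol_MSE_le_of_prec hn hm hδ hδ1 hp1 hγ hκ hγκ hK hKn).trans
      (ENNReal.ofReal_le_ofReal ?_)
    have hL : 0 ≤ Real.log (2 * m / δ) := by
      rw [← div_div_eq_mul_div]
      exact log_two_div_nonneg hm hδ hδ1
    have hcube := one_add_cube_div_le hm h0 h1 hl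
    have hcoef : 224 * K / (1 - κ) ^ 2 ≤ 224 * (512 * 8) / (1 - κ) ^ 2 :=
      div_le_div_of_nonneg_right (by linarith) (sq_nonneg _)
    calc 224 * K / (1 - κ) ^ 2 * Real.log (2 * m / δ) * (1 + (m : ℝ) ^ 3 / ε ^ 2)
        ≤ 224 * (512 * 8) / (1 - κ) ^ 2 * Real.log (2 * m / δ) *
            (16 * (Real.log (Real.log n) ^ 3 / ε ^ 2)) :=
          mul_le_mul (mul_le_mul_of_nonneg_right hcoef hL) hcube (by positivity) (by positivity)
      _ = _ := by ring
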